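/- Let $T,O,I\subset SO(3)$ denote the rotation groups of a regular tetrahedron, octahedron and icosahedron centred at the origin, in any position. For $G\in\{T,O,I\}$ let $\Gamma^1,\dots,\Gamma^{N_{\rm rep}}$ be a complete list of pairwise inequivalent irreducible complex unitary matrix representations of $G$, with $\Gamma^p$ of dimension $d_p$. A basis function for $\Gamma^p$ is a vector function $f=(f_1,\dots,f_{d_p})$ with components in $L^2(S^2)$ (complex-valued functions, surface measure) such that $f(g^{-1}x)=\Gamma^p(g)^{T}f(x)$ for all $g\in G$ and almost every $x\in S^2$. Let $L_2^p$ be the closed subspace of $L^2(S^2)$ spanned by the components of all basis functions for $\Gamma^p$. A real orthonormal system of basis functions of $G$ is a family of basis functions $I_{p;\zeta}$ for $\Gamma^p$ ($1\le p\le N_{\rm rep}$, with $\zeta$ in an arbitrary index set depending on $p$) whose components are real-valued and, for all $p$, $\zeta$ together, orthonormal in $L^2(S^2)$. (1) If $G=O$ or $G=I$, then for a suitable choice of the matrices $\Gamma^p$ within their equivalence classes there are integers $N_{p;l}\ge 0$ and a real orthonormal system of basis functions $I_{p;l,n}$ ($1\le p\le N_{\rm rep}$, $l=0,1,2,\dots$,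 $1\le n\le N_{p;l}$) such that every component of $I_{p;l,n}$ is a spherical harmonic of degree $l$ (a linear combination of $Y_{l,-l},\dots,Y_{l,l}$), and such that the components of all the $I_{p;l,n}$ form a complete orthonormal system of $L^2(S^2)$. (2) Let $G=T$, with $N_{\rm rep}=4$ and the irreducible representations numbered so that $(d_1,d_2,d_3,d_4)=(1,1,1,3)$ and $\Gamma^1$ is trivial. Then for every choice of the matrices $\Gamma^p$, no real orthonormal system of basis functions of $G$ is complete in $L^2(S^2)$; every such system contains no function with $p=2$ or $p=3$, and the closed span of its components is contained in the closed span of $L_2^1$ and $L_2^4$. Moreover, for a suitable choice of the matrices $\Gamma^p$ there is a real orthonormal system of basis functions $I_{p;l,n}$, with components that are spherical harmonics of degree $l$, such that for $p=1$ and for $p=4$ the components of the $I_{p;l,n}$ have closed span exactly $L_2^p$. -/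

import Mathlib

open MeasureTheory

noncomputable section

namespace Polyhedral

/-! ### Polyhedral rotation groups -/

/-- Three-dimensional Euclidean space. -/
abbrev E3 : Type := EuclideanSpace ℝ (Fin 3)

/-- The group of rotations (linear isometries of determinant one) which map `V` onto itself. -/
def rotationGroup (V : Set E3) : Subgroup (E3 ≃ₗᵢ[ℝ] E3) where
  carrier := {g | LinearMap.det (g.toLinearEquiv : E3 →ₗ[ℝ] E3) = 1 ∧ g '' V = V}
  one_mem' := by
    refine ⟨?_, ?_⟩
    · have h : ((1 : E3 ≃ₗᵢ[ℝ] E3).toLinearEquiv : E3 →ₗ[ℝ] E3) = LinearMap.id := rfl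
      rw [h, LinearMap.det_id]
    · simp
  mul_mem' := by
    rintro a b ⟨ha, ha'⟩ ⟨hb, hb'⟩
    refine ⟨?_, ?_⟩
    · have h : ((a * b).toLinearEquiv : E3 →ₗ[ℝ] E3) =
          (a.toLinearEquiv : E3 →ₗ[ℝ] E3) ∘ₗ (b.toLinearEquiv : E3 →ₗ[ℝ] E3) := rfl
      rw [h, LinearMap.det_comp, ha, hb, one_mul]
    · have h : (⇑(a * b) : E3 → E3) = a ∘ b := rfl
      rw [h, Set.image_comp, hb', ha']
  inv_mem' := by
    rintro a ⟨ha, ha'⟩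
    refine ⟨?_, ?_⟩
    · have h : ((a⁻¹).toLinearEquiv : E3 →ₗ[ℝ] E3) ∘ₗ (a.toLinearEquiv : E3 →ₗ[ℝ] E3) =
          LinearMap.id := by
        ext1 x
        exact a.symm_apply_apply x
      have h2 := congrArg LinearMap.det h
      rw [LinearMap.det_comp, ha, mul_one, LinearMap.det_id] at h2
      exact h2
    · have h : (⇑(a⁻¹) : E3 → E3) '' (a '' V) = V := by
        rw [← Set.image_comp]
        have h3 : (⇑(a⁻¹) : E3 → E3) ∘ a = id := by
          funext x
          exact a.symm_apply_apply x
        rw [h3, Set.image_id]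
      rw [ha'] at h
      exact h

/-- The vertices of a regular tetrahedron centred at the origin. -/
def tetrahedronVertices : Set E3 :=
  {!₂[1, 1, 1], !₂[1, -1, -1], !₂[-1, 1, -1], !₂[-1, -1, 1]}

/-- The vertices of a regular octahedron centred at the origin. -/
def octahedronVertices : Set E3 :=
  {!₂[1, 0, 0], !₂[-1, 0, 0], !₂[0, 1, 0], !₂[0, -1, 0], !₂[0, 0, 1], !₂[0, 0, -1]}

/-- The vertices `(0, ±1, ±φ)`, `(±1, ±φ, 0)`, `(±φ, 0, ±1)` of a regular icosahedron centred at
the origin, where `φ` is the golden ratio. -/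
def icosahedronVertices : Set E3 :=
  {x | ∃ s t : ℝ, (s = 1 ∨ s = -1) ∧ (t = 1 ∨ t = -1) ∧
    (x = !₂[0, s, t * Real.goldenRatio] ∨ x = !₂[s, t * Real.goldenRatio, 0] ∨
      x = !₂[t * Real.goldenRatio, 0, s])}

/-- `G` is the rotation group of a regular tetrahedron, in some position around the origin. -/
def IsTetrahedral (G : Subgroup (E3 ≃ₗᵢ[ℝ] E3)) : Prop :=
  ∃ Q : E3 ≃ₗᵢ[ℝ] E3, G = rotationGroup (Q '' tetrahedronVertices)

/-- `G` is the rotation group of a regular octahedron, in some position around the origin. -/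
def IsOctahedral (G : Subgroup (E3 ≃ₗᵢ[ℝ] E3)) : Prop :=
  ∃ Q : E3 ≃ₗᵢ[ℝ] E3, G = rotationGroup (Q '' octahedronVertices)

/-- `G` is the rotation group of a regular icosahedron, in some position around the origin. -/
def IsIcosahedral (G : Subgroup (E3 ≃ₗᵢ[ℝ] E3)) : Prop :=
  ∃ Q : E3 ≃ₗᵢ[ℝ] E3, G = rotationGroup (Q '' icosahedronVertices)

/-! ### Irreducible matrix representations -/

/-- The representation on column vectors given by a matrix representation. -/
def matRep {G : Type*} [Group G] {d : ℕ} (Γ : G →* Matrix (Fin d) (Fin d) ℂ) :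
    Representation ℂ G (Fin d → ℂ) :=
  (Matrix.toLinAlgEquiv' (R := ℂ) (n := Fin d)).toAlgHom.toMonoidHom.comp Γ

/-- A list of `r` complex unitary matrix representations of `G` which are irreducible, pairwise
inequivalent, and represent every equivalence class of (finite-dimensional) irreducible complex
representations of `G`; `d p` is the dimension and `Γ p` are the matrices of the `p`-th one. -/
structure IrrepList (G : Type*) [Group G] (r : ℕ) where
  d : Fin r → ℕ
  Γ : ∀ p, G →* Matrix (Fin (d p)) (Fin (d p)) ℂ
  unitary : ∀ p g, Γ p g ∈ Matrix.unitaryGroup (Fin (d p)) ℂ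
  irreducible : ∀ p, (matRep (Γ p)).IsIrreducible
  inequivalent : ∀ p q, Nonempty ((matRep (Γ p)).Equiv (matRep (Γ q))) → p = q
  exhaustive : ∀ (n : ℕ) (Δ : G →* Matrix (Fin n) (Fin n) ℂ), (matRep Δ).IsIrreducible →
    ∃ p, Nonempty ((matRep (Γ p)).Equiv (matRep Δ))

/-- The numbering of the four irreducible representations of the tetrahedral group: the first one
is trivial, the second and the third are one-dimensional, the fourth is three-dimensional. -/
def IrrepList.IsTetrahedralNumbering {G : Type*} [Group G] (A : IrrepList G 4) : Prop :=
  A.d = ![1, 1, 1, 3] ∧ ∀ g, A.Γ 0 g = 1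

/-! ### Square integrable functions and spherical harmonics on the unit sphere -/

/-- The unit sphere. -/
abbrev S2 : Type := Metric.sphere (0 : E3) 1

/-- The surface measure on the unit sphere. -/
abbrev surface : Measure S2 := (volume : Measure E3).toSphere

/-- The Hilbert space of complex square integrable functions on the unit sphere. -/
abbrev L2S : Type := Lp ℂ 2 surface

/-- A linear isometry acting on the unit sphere. -/
def actS (g : E3 ≃ₗᵢ[ℝ] E3) (x : S2) : S2 :=
  ⟨g x, by simp⟩

/-- `f` is a spherical harmonic of degree `l`: the restriction to the sphere of a harmonic
homogeneous polynomial of degree `l` (equivalently, a linear combination of the functions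
`Y_{l,m}` with `-l ≤ m ≤ l`). -/
def IsSphericalHarmonic (l : ℕ) (f : L2S) : Prop :=
  ∃ P : MvPolynomial (Fin 3) ℂ, P.IsHomogeneous l ∧
    ∑ i, MvPolynomial.pderiv i (MvPolynomial.pderiv i P) = 0 ∧
    ∀ᵐ x ∂surface, f x = MvPolynomial.eval (fun i => ((x : E3) i : ℂ)) P

/-- `f` is real-valued. -/
def IsRealValued (f : L2S) : Prop :=
  ∀ᵐ x ∂surface, (f x).im = 0

/-! ### Symmetry-adapted basis functions -/

section Basis

variable {G : Subgroup (E3 ≃ₗᵢ[ℝ] E3)}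

/-- The vector function `f` is a basis function for the matrix representation `Γ`:
`f (R_g⁻¹ x) = Γ(g)ᵀ f (x)` for all `g` in the group. -/
def IsBasisFunction {d : ℕ} (Γ : G →* Matrix (Fin d) (Fin d) ℂ) (f : Fin d → L2S) : Prop :=
  ∀ g : G, ∀ᵐ x ∂surface, ∀ j,
    f j (actS (g : E3 ≃ₗᵢ[ℝ] E3)⁻¹ x) = ((Γ g).transpose.mulVec (fun k => f k x)) j

/-- The closed subspace spanned by the components of all complex basis functions for `Γ` (the
isotypic subspace of `Γ`). -/
def isotypic {d : ℕ} (Γ : G →* Matrix (Fin d) (Fin d) ℂ) : Submodule ℂ L2S :=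
  (Submodule.span ℂ {h | ∃ f : Fin d → L2S, IsBasisFunction Γ f ∧ ∃ j, h = f j}).topologicalClosure

/-- `I p z`, for `z : ζ p`, are real-valued basis functions for the `p`-th irreducible
representation in the list `A`, and all their components together are orthonormal. -/
structure IsRealOrthonormalBasisSystem {r : ℕ} (A : IrrepList G r) {ζ : Fin r → Type*}
    (I : ∀ p, ζ p → Fin (A.d p) → L2S) : Prop where
  real : ∀ p z j, IsRealValued (I p z j)
  transforms : ∀ p z, IsBasisFunction (A.Γ p) (I p z)
  orthonormal : Orthonormal ℂ
    (fun i : Σ p, ζ p × Fin (A.d p) => I i.1 i.2.1 i.2.2)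

/-- The closed subspace spanned by the components of the basis functions for the `p`-th irreducible
representation. -/
def closedSpanAt {r : ℕ} {A : IrrepList G r} {ζ : Fin r → Type*}
    (I : ∀ p, ζ p → Fin (A.d p) → L2S) (p : Fin r) : Submodule ℂ L2S :=
  (Submodule.span ℂ {h | ∃ z j, h = I p z j}).topologicalClosure

/-- The closed subspace spanned by the components of all basis functions of the system. -/
def closedSpan {r : ℕ} {A : IrrepList G r} {ζ : Fin r → Type*}
    (I : ∀ p, ζ p → Fin (A.d p) → L2S) : Submodule ℂ L2S :=
  (Submodule.span ℂ {h | ∃ p z j, h = I p z j}).topologicalClosure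

end Basis

end Polyhedral

end

/-!
The orthogonal projection of `L²` onto the spherical harmonics of degree `l` commutes with rotations
and with complex conjugation. Hence, for real matrices `Γ`, the basis functions for `Γ` of degree
`l` form a finite-dimensional space with a real structure; by Schur's lemma a real orthonormal basis
of it has orthonormal components, and the components of all degrees have closed span `isotypic Γ`.
So the isotypic subspaces of the representations with real matrices have real bases, and together
all isotypic subspaces span `L²`.

An irreducible representation `ρ` can be given real matrices if some vector `u ≠ 0` is fixed up to
sign by a subgroup `D` such that every coset of `D` contains an element with square one: an
invariant Hermitian form is then real on the orbit of `u`, so the real span of the orbit is a real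
form of `ρ`. For the octahedral group `D` is generated by two commuting half turns, for the
icosahedral group it is a dihedral group of order six.

A nontrivial one-dimensional representation of the tetrahedral group has order three, so it is not
real and has no real basis functions, although it occurs in `L²` because the translations by
distinct rotations are linearly independent.
-/

namespace Polyhedral

/-! ### Matrix representations of finite groups -/

section SchurOrthogonality

variable {G : Type*} [Group G] {d e : ℕ} {Γ : G →* Matrix (Fin d) (Fin d) ℂ}
  {Δ : G →* Matrix (Fin e) (Fin e) ℂ}

lemma matRep_apply (Γ : G →* Matrix (Fin d) (Fin d) ℂ) (g : G) (v : Fin d → ℂ) :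
    matRep Γ g v = (Γ g).mulVec v := rfl

/-- The intertwining map `v ↦ A v` given by a matrix `A` with `Γ g * A = A * Δ g`. -/
def intertwiningMapOfMatrix (A : Matrix (Fin d) (Fin e) ℂ) (hA : ∀ g, Γ g * A = A * Δ g) :
    (matRep Δ).IntertwiningMap (matRep Γ) where
  toLinearMap := A.mulVecLin
  isIntertwining' g := LinearMap.ext fun v => by
    simp [matRep_apply, Matrix.mulVec_mulVec, hA]

lemma matrix_eq_zero_of_inequivalent (hΓ : (matRep Γ).IsIrreducible)
    (hΔ : (matRep Δ).IsIrreducible) (hne : IsEmpty ((matRep Δ).Equiv (matRep Γ)))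
    {A : Matrix (Fin d) (Fin e) ℂ} (hA : ∀ g, Γ g * A = A * Δ g) : A = 0 := by
  have h0 : intertwiningMapOfMatrix A hA = 0 := Subsingleton.elim _ _
  refine Matrix.mulVec_injective (funext fun v => ?_)
  have hv : A.mulVec v = 0 :=
    congrArg (fun f : (matRep Δ).IntertwiningMap (matRep Γ) => f v) h0
  rw [hv, Matrix.zero_mulVec]

lemma exists_eq_smul_one_of_commute (hΓ : (matRep Γ).IsIrreducible)
    {A : Matrix (Fin d) (Fin d) ℂ} (hA : ∀ g, Γ g * A = A * Γ g) : ∃ c : ℂ, A = c • 1 := by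
  have hsurj := (Representation.IsIrreducible.algebraMap_intertwiningMap_bijective_of_isAlgClosed
    (ρ := matRep Γ)).2
  obtain ⟨c, hc⟩ := hsurj (intertwiningMapOfMatrix A hA)
  refine ⟨c, Matrix.mulVec_injective (funext fun v => ?_)⟩
  have hv : c • v = A.mulVec v :=
    congrArg (fun f : (matRep Γ).IntertwiningMap (matRep Γ) => f v) hc
  rw [← hv, Matrix.smul_mulVec, Matrix.one_mulVec]

lemma nontrivial_of_isIrreducible {k V : Type*} [Field k] [AddCommGroup V] [Module k V]
    {ρ : Representation k G V} (hρ : ρ.IsIrreducible) : Nontrivial V := by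
  obtain ⟨S, T, hST⟩ := hρ.toNontrivial
  refine not_subsingleton_iff_nontrivial.mp fun _ => hST ?_
  exact Subrepresentation.toSubmodule_injective (Subsingleton.elim _ _)

lemma dim_ne_zero_of_isIrreducible (hΓ : (matRep Γ).IsIrreducible) : d ≠ 0 := by
  rintro rfl
  exact not_nontrivial _ (nontrivial_of_isIrreducible hΓ)

section FiniteSums

variable [Fintype G]

lemma mul_sum_inv_mul_mul (Γ : G →* Matrix (Fin d) (Fin d) ℂ)
    (Δ : G →* Matrix (Fin e) (Fin e) ℂ) (E : Matrix (Fin d) (Fin e) ℂ) (h : G) :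
    Γ h * (∑ g, Γ g⁻¹ * E * Δ g) = (∑ g, Γ g⁻¹ * E * Δ g) * Δ h := by
  rw [Matrix.mul_sum, Matrix.sum_mul, ← Equiv.sum_comp (Equiv.mulRight h)]
  refine Finset.sum_congr rfl fun g _ => ?_
  simp only [Equiv.coe_mulRight, mul_inv_rev, map_mul, Matrix.mul_assoc]
  rw [← Matrix.mul_assoc (Γ h), ← map_mul, mul_inv_cancel, map_one, Matrix.one_mul]

lemma sum_inv_mul_single_mul_apply (Γ : G →* Matrix (Fin d) (Fin d) ℂ)
    (Δ : G →* Matrix (Fin e) (Fin e) ℂ) (i j : Fin d) (k l : Fin e) :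
    (∑ g, Γ g⁻¹ * Matrix.single j k (1 : ℂ) * Δ g) i l = ∑ g, Γ g⁻¹ i j * Δ g k l := by
  rw [Matrix.sum_apply]
  refine Finset.sum_congr rfl fun g _ => ?_
  rw [Matrix.mul_assoc, Matrix.mul_apply, Finset.sum_eq_single j]
  · simp
  · exact fun b _ hb => by rw [Matrix.single_mul_apply_of_ne _ _ _ _ _ hb, mul_zero]
  · simp

lemma sum_inv_mul_of_inequivalent (hΓ : (matRep Γ).IsIrreducible)
    (hΔ : (matRep Δ).IsIrreducible) (hne : IsEmpty ((matRep Δ).Equiv (matRep Γ)))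
    (i j : Fin d) (k l : Fin e) : ∑ g, Γ g⁻¹ i j * Δ g k l = 0 := by
  rw [← sum_inv_mul_single_mul_apply,
    matrix_eq_zero_of_inequivalent hΓ hΔ hne (mul_sum_inv_mul_mul Γ Δ _), Matrix.zero_apply]

lemma sum_inv_mul_self (hΓ : (matRep Γ).IsIrreducible) (i j k l : Fin d) :
    ∑ g, Γ g⁻¹ i j * Γ g k l = if i = l ∧ j = k then (Fintype.card G / d : ℂ) else 0 := by
  obtain ⟨c, hc⟩ := exists_eq_smul_one_of_commute hΓ
    (mul_sum_inv_mul_mul Γ Γ (Matrix.single j k 1))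
  have trace_conj (g : G) :
      (Γ g⁻¹ * Matrix.single j k (1 : ℂ) * Γ g).trace = if j = k then 1 else 0 := by
    rw [Matrix.trace_mul_comm, ← Matrix.mul_assoc, ← map_mul, mul_inv_cancel, map_one,
      Matrix.one_mul]
    split_ifs with h
    · simp [h]
    · exact Matrix.trace_single_eq_of_ne _ _ _ h
  have hd : (d : ℂ) ≠ 0 := by exact_mod_cast dim_ne_zero_of_isIrreducible hΓ
  have hcd : c * d = if j = k then (Fintype.card G : ℂ) else 0 := by
    have h := congrArg Matrix.trace hc
    rw [Matrix.trace_sum, Finset.sum_congr rfl fun g _ => trace_conj g] at h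
    simpa using h.symm
  rw [← sum_inv_mul_single_mul_apply, hc, Matrix.smul_apply, Matrix.one_apply,
    eq_div_of_mul_eq hd hcd]
  by_cases hil : i = l <;> by_cases hjk : j = k <;> simp [hil, hjk]

end FiniteSums

variable [Finite G] {ι : Type*} {n : ι → ℕ} {Λ : ∀ p, G →* Matrix (Fin (n p)) (Fin (n p)) ℂ}

lemma linearIndependent_matrixEntries (hirr : ∀ p, (matRep (Λ p)).IsIrreducible)
    (hne : ∀ p q, Nonempty ((matRep (Λ p)).Equiv (matRep (Λ q))) → p = q) :
    LinearIndependent ℂ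
      (fun (x : Σ p, Fin (n p) × Fin (n p)) (g : G) => Λ x.1 g x.2.1 x.2.2) := by
  have := Fintype.ofFinite G
  let dual (x : Σ p, Fin (n p) × Fin (n p)) : Module.Dual ℂ (G → ℂ) :=
    (n x.1 / Fintype.card G : ℂ) • ∑ g, Λ x.1 g⁻¹ x.2.2 x.2.1 • LinearMap.proj g
  have dual_apply (x) (a : G → ℂ) :
      dual x a = n x.1 / Fintype.card G * ∑ g, Λ x.1 g⁻¹ x.2.2 x.2.1 * a g := by
    simp [dual]
  refine .of_pairwise_dual_eq_zero_one _ dual ?_ ?_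
  · rintro ⟨p, i, j⟩ ⟨q, k, l⟩ hpq
    rw [dual_apply]
    rcases eq_or_ne p q with rfl | hne'
    · rw [sum_inv_mul_self (hirr p), if_neg (by rintro ⟨rfl, rfl⟩; exact hpq rfl), mul_zero]
    · rw [sum_inv_mul_of_inequivalent (hirr p) (hirr q)
        (not_nonempty_iff.mp fun h => hne' (hne _ _ h).symm), mul_zero]
  · rintro ⟨p, i, j⟩
    have hn : (n p : ℂ) ≠ 0 := by exact_mod_cast dim_ne_zero_of_isIrreducible (hirr p)
    have hG : (Fintype.card G : ℂ) ≠ 0 := by exact_mod_cast Fintype.card_ne_zero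
    rw [dual_apply, sum_inv_mul_self (hirr p), if_pos ⟨rfl, rfl⟩]
    field_simp

lemma finite_of_inequivalent (hirr : ∀ p, (matRep (Λ p)).IsIrreducible)
    (hne : ∀ p q, Nonempty ((matRep (Λ p)).Equiv (matRep (Λ q))) → p = q) : Finite ι := by
  have hpos (p) : 0 < n p := Nat.pos_of_ne_zero (dim_ne_zero_of_isIrreducible (hirr p))
  have : Finite (Σ p, Fin (n p) × Fin (n p)) :=
    (linearIndependent_matrixEntries hirr hne).finite
  exact .of_injective (fun p => (⟨p, ⟨0, hpos p⟩, ⟨0, hpos p⟩⟩ : Σ p, Fin (n p) × Fin (n p)))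
    fun p q hpq => congrArg Sigma.fst hpq

lemma sum_sq_dim_le_card [Fintype ι] (hirr : ∀ p, (matRep (Λ p)).IsIrreducible)
    (hne : ∀ p q, Nonempty ((matRep (Λ p)).Equiv (matRep (Λ q))) → p = q) :
    ∑ p, n p ^ 2 ≤ Nat.card G := by
  have := Fintype.ofFinite G
  simpa [sq] using (linearIndependent_matrixEntries hirr hne).fintype_card_le_finrank

lemma exists_equiv_of_card_le_sum_sq_dim [Fintype ι] (hirr : ∀ p, (matRep (Λ p)).IsIrreducible)
    (hne : ∀ p q, Nonempty ((matRep (Λ p)).Equiv (matRep (Λ q))) → p = q)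
    (hcard : Nat.card G ≤ ∑ p, n p ^ 2) (hΔ : (matRep Δ).IsIrreducible) :
    ∃ p, Nonempty ((matRep (Λ p)).Equiv (matRep Δ)) := by
  by_contra! hΔne
  let F : Option ι → Σ m, G →* Matrix (Fin m) (Fin m) ℂ :=
    fun o => o.elim ⟨e, Δ⟩ fun p => ⟨n p, Λ p⟩
  have hF : ∑ o, (F o).1 ^ 2 ≤ Nat.card G := by
    refine sum_sq_dim_le_card (Λ := fun o => (F o).2) (Option.rec hΔ hirr) ?_
    rintro (_ | p) (_ | q) ⟨f⟩
    · rfl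
    · exact ((hΔne q).false f.symm).elim
    · exact ((hΔne p).false f).elim
    · exact congrArg some (hne p q ⟨f⟩)
  have he : 0 < e ^ 2 := pow_pos (Nat.pos_of_ne_zero (dim_ne_zero_of_isIrreducible hΔ)) 2
  rw [Fintype.sum_option] at hF
  exact (hF.trans hcard).not_gt (Nat.lt_add_of_pos_left he)

end SchurOrthogonality

/-! ### Realizability over the real numbers -/

section Realizability

open scoped InnerProductSpace

variable {G : Type*} [Group G]

/-- The matrices of `Γ` have real entries; they are kept as complex matrices so that `Γ` can be a
member of an `IrrepList`. -/
def HasRealEntries {d : ℕ} (Γ : G →* Matrix (Fin d) (Fin d) ℂ) : Prop :=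
  ∀ g i j, (Γ g i j).im = 0

/-- A complex representation is realizable over `ℝ` if it is equivalent to a representation by real
orthogonal matrices. -/
def IsRealizable {V : Type*} [AddCommGroup V] [Module ℂ V] (ρ : Representation ℂ G V) : Prop :=
  ∃ (d : ℕ) (Γ : G →* Matrix (Fin d) (Fin d) ℂ), (∀ g, Γ g ∈ Matrix.unitaryGroup (Fin d) ℂ) ∧
    HasRealEntries Γ ∧ Nonempty ((matRep Γ).Equiv ρ)

lemma exists_orthonormal_sum_inner_smul {E : Type*} [NormedAddCommGroup E] [InnerProductSpace ℂ E]
    (W : Submodule ℝ E) [FiniteDimensional ℝ W] (hW : ∀ x ∈ W, ∀ y ∈ W, (⟪x, y⟫_ℂ).im = 0) :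
    ∃ (n : ℕ) (b : Fin n → E), Orthonormal ℂ b ∧ (∀ i, b i ∈ W) ∧
      ∀ x ∈ W, ∑ i, ⟪b i, x⟫_ℂ • b i = x := by
  let _ : InnerProductSpace ℝ E := InnerProductSpace.complexToReal
  -- `W`, with its scalar multiplication read off from the real inner product.
  let W' : @Submodule ℝ E _ _ (InnerProductSpace.complexToReal (G := E)).toNormedSpace.toModule := W
  have : FiniteDimensional ℝ W' := ‹FiniteDimensional ℝ W›
  have inner_eq (x y : W') : ⟪(x : E), y⟫_ℂ = (⟪x, y⟫_ℝ : ℝ) :=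
    Complex.ext rfl (hW _ x.2 _ y.2)
  let b := stdOrthonormalBasis ℝ W'
  refine ⟨_, fun i => b i, ?_, fun i => (b i).2, fun x hx => ?_⟩
  · refine orthonormal_iff_ite.mpr fun i j => ?_
    rw [inner_eq, orthonormal_iff_ite.mp b.orthonormal i j]
    split_ifs <;> simp
  · have hsum := congrArg Subtype.val (b.sum_repr' (⟨x, hx⟩ : W'))
    simp only [Submodule.coe_sum, Submodule.coe_smul] at hsum
    refine Eq.trans (Finset.sum_congr rfl fun i _ => ?_) hsum
    rw [inner_eq (b i) ⟨x, hx⟩, Complex.coe_smul]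

lemma inner_im_eq_zero_of_mem_span {E : Type*} [NormedAddCommGroup E] [InnerProductSpace ℂ E]
    {s : Set E} (hs : ∀ x ∈ s, ∀ y ∈ s, (⟪x, y⟫_ℂ).im = 0) {x y : E}
    (hx : x ∈ Submodule.span ℝ s) (hy : y ∈ Submodule.span ℝ s) : (⟪x, y⟫_ℂ).im = 0 := by
  induction hx, hy using Submodule.span_induction₂ with
  | mem_mem x y hx hy => exact hs x hx y hy
  | zero_left => simp
  | zero_right => simp
  | add_left _ _ _ _ _ _ h₁ h₂ => simp [h₁, h₂]
  | add_right _ _ _ _ _ _ h₁ h₂ => simp [h₁, h₂]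
  | smul_left r x y _ _ h => rw [← Complex.coe_smul, inner_smul_left]; simp [h]
  | smul_right r x y _ _ h => rw [← Complex.coe_smul, inner_smul_right]; simp [h]

lemma span_orbit_le_comap {k k' V : Type*} [CommRing k] [CommRing k'] [AddCommGroup V]
    [Module k V] [Module k' V] [SMul k' k] [IsScalarTower k' k V] (ρ : Representation k G V)
    (u : V) (g : G) :
    Submodule.span k' (Set.range fun h => ρ h u) ≤
      (Submodule.span k' (Set.range fun h => ρ h u)).comap ((ρ g).restrictScalars k') := by
  refine Submodule.span_le.mpr (Set.range_subset_iff.mpr fun h => ?_)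
  refine Submodule.subset_span ⟨g * h, ?_⟩
  simp only [map_mul, Module.End.mul_apply, LinearMap.restrictScalars_apply]

lemma span_orbit_eq_top {k V : Type*} [Field k] [AddCommGroup V] [Module k V]
    {ρ : Representation k G V} (hρ : ρ.IsIrreducible) {u : V} (hu : u ≠ 0) :
    Submodule.span k (Set.range fun g => ρ g u) = ⊤ := by
  let S : Subrepresentation ρ :=
    ⟨Submodule.span k (Set.range fun g => ρ g u), fun g _ hv => span_orbit_le_comap ρ u g hv⟩
  have hu_mem : u ∈ S.toSubmodule := Submodule.subset_span ⟨1, by simp⟩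
  refine congrArg Subrepresentation.toSubmodule ((hρ.eq_bot_or_eq_top S).resolve_left fun h => ?_)
  rw [h] at hu_mem
  exact hu ((Submodule.mem_bot k).mp hu_mem)

/-- The matrix representation given by a representation and a basis. -/
noncomputable def matrixRepOfBasis {V : Type*} [AddCommGroup V] [Module ℂ V] {d : ℕ}
    (b : Module.Basis (Fin d) ℂ V) (ρ : Representation ℂ G V) : G →* Matrix (Fin d) (Fin d) ℂ :=
  (LinearMap.toMatrixAlgEquiv b).toAlgHom.toMonoidHom.comp ρ

lemma nonempty_equiv_matrixRepOfBasis {V : Type*} [AddCommGroup V] [Module ℂ V] {d : ℕ}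
    (b : Module.Basis (Fin d) ℂ V) (ρ : Representation ℂ G V) :
    Nonempty ((matRep (matrixRepOfBasis b ρ)).Equiv ρ) := by
  refine ⟨.mk b.equivFun.symm fun g => LinearMap.ext fun v => b.equivFun.injective ?_⟩
  obtain ⟨w, rfl⟩ := b.equivFun.surjective v
  rw [LinearMap.comp_apply, LinearMap.comp_apply, LinearEquiv.coe_coe, LinearEquiv.apply_symm_apply,
    LinearEquiv.symm_apply_apply]
  exact LinearMap.toMatrix_mulVec_repr b b (ρ g) w

section Orthonormal

variable {V : Type*} [NormedAddCommGroup V] [InnerProductSpace ℂ V] {ρ : Representation ℂ G V}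

lemma matrixRepOfBasis_apply {d : ℕ} (b : OrthonormalBasis (Fin d) ℂ V) (g : G) (i j : Fin d) :
    matrixRepOfBasis b.toBasis ρ g i j = ⟪b i, ρ g (b j)⟫_ℂ := by
  rw [← b.repr_apply_apply, ← b.coe_toBasis_repr_apply]
  exact (LinearMap.toMatrixAlgEquiv_apply b.toBasis (ρ g) i j).trans (by rw [b.coe_toBasis])

lemma matrixRepOfBasis_mem_unitaryGroup (hρ : ∀ g x y, ⟪ρ g x, ρ g y⟫_ℂ = ⟪x, y⟫_ℂ) {d : ℕ}
    (b : OrthonormalBasis (Fin d) ℂ V) (g : G) :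
    matrixRepOfBasis b.toBasis ρ g ∈ Matrix.unitaryGroup (Fin d) ℂ := by
  refine Matrix.mem_unitaryGroup_iff'.mpr (Matrix.ext fun i j => ?_)
  rw [Matrix.mul_apply, Matrix.one_apply, ← orthonormal_iff_ite.mp b.orthonormal, ← hρ g,
    ← b.sum_inner_mul_inner]
  refine Finset.sum_congr rfl fun l _ => ?_
  rw [Matrix.star_apply, matrixRepOfBasis_apply, matrixRepOfBasis_apply]
  exact congrArg (· * _) (inner_conj_symm _ _)

lemma isRealizable_of_inner_orbit_im_eq_zero [Finite G]
    (hinv : ∀ g x y, ⟪ρ g x, ρ g y⟫_ℂ = ⟪x, y⟫_ℂ) (hρ : ρ.IsIrreducible) {u : V} (hu : u ≠ 0)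
    (hreal : ∀ g, (⟪u, ρ g u⟫_ℂ).im = 0) : IsRealizable ρ := by
  let W : Submodule ℝ V := Submodule.span ℝ (Set.range fun g => ρ g u)
  have : FiniteDimensional ℝ W := FiniteDimensional.span_of_finite ℝ (Set.finite_range _)
  have orbit_real : ∀ x ∈ Set.range (fun g => ρ g u), ∀ y ∈ Set.range (fun g => ρ g u),
      (⟪x, y⟫_ℂ).im = 0 := by
    rintro _ ⟨g, rfl⟩ _ ⟨h, rfl⟩
    have hgh := hreal (g⁻¹ * h)
    rwa [← hinv g, ← Module.End.mul_apply, ← map_mul, mul_inv_cancel_left] at hgh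
  have W_real : ∀ x ∈ W, ∀ y ∈ W, (⟪x, y⟫_ℂ).im = 0 :=
    fun x hx y hy => inner_im_eq_zero_of_mem_span orbit_real hx hy
  obtain ⟨d, b, hb, hbW, hsum⟩ := exists_orthonormal_sum_inner_smul W W_real
  have hspan : ⊤ ≤ Submodule.span ℂ (Set.range b) := by
    rw [← span_orbit_eq_top hρ hu, Submodule.span_le, Set.range_subset_iff]
    intro g
    rw [SetLike.mem_coe, ← hsum (ρ g u) (Submodule.subset_span ⟨g, rfl⟩)]
    exact Submodule.sum_mem _ fun i _ => Submodule.smul_mem _ _ (Submodule.subset_span ⟨i, rfl⟩)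
  let B := OrthonormalBasis.mk hb hspan
  have hB (i) : B i ∈ W := by simpa [B] using hbW i
  refine ⟨d, matrixRepOfBasis B.toBasis ρ, matrixRepOfBasis_mem_unitaryGroup hinv B,
    fun g i j => ?_, nonempty_equiv_matrixRepOfBasis _ ρ⟩
  rw [matrixRepOfBasis_apply]
  exact W_real _ (hB i) _ (span_orbit_le_comap (k' := ℝ) ρ u g (hB j))

end Orthonormal

section Signs

variable {V : Type*} [AddCommGroup V] [Module ℂ V]

lemma exists_invariant_inner [Finite G] [FiniteDimensional ℂ V] (ρ : Representation ℂ G V) :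
    ∃ c : InnerProductSpace.Core ℂ V, ∀ g x y, c.inner (ρ g x) (ρ g y) = c.inner x y := by
  have := Fintype.ofFinite G
  let e : V ≃ₗ[ℂ] EuclideanSpace ℂ (Fin (Module.finrank ℂ V)) :=
    (Module.finBasis ℂ V).equivFun ≪≫ₗ (WithLp.linearEquiv 2 ℂ _).symm
  let Φ : V →ₗ[ℂ] PiLp 2 fun _ : G => EuclideanSpace ℂ (Fin (Module.finrank ℂ V)) :=
    (WithLp.linearEquiv 2 ℂ _).symm.toLinearMap ∘ₗ LinearMap.pi fun g => e.toLinearMap ∘ₗ ρ g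
  have hΦ : Function.Injective Φ := fun x y hxy => e.injective (by
    simpa [Φ] using congrArg (fun f => f.ofLp 1) hxy)
  refine ⟨{ inner x y := ⟪Φ x, Φ y⟫_ℂ
            conj_inner_symm x y := inner_conj_symm _ _
            re_inner_nonneg x := inner_self_nonneg
            add_left x y z := by rw [map_add, inner_add_left]
            smul_left x y c := by rw [map_smul, inner_smul_left]
            definite x hx := hΦ (by rw [map_zero]; exact inner_self_eq_zero.mp hx) },
    fun g x y => ?_⟩
  have shift (z : V) (h : G) : (Φ (ρ g z)).ofLp h = (Φ z).ofLp (h * g) := by simp [Φ]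
  refine Eq.trans (Finset.sum_congr rfl fun h _ => ?_) (Equiv.sum_comp (Equiv.mulRight g) _)
  exact congrArg₂ _ (shift x h) (shift y h)

/-- The subgroup of the elements which fix `u` up to a sign. -/
def signStabilizer (ρ : Representation ℂ G V) (u : V) : Subgroup G where
  carrier := {g | ρ g u = u ∨ ρ g u = -u}
  one_mem' := .inl (by simp)
  mul_mem' := by
    rintro g h hg (hh | hh) <;> rcases hg with hg | hg <;> simp [hg, hh]
  inv_mem' := by
    rintro g (hg | hg)
    · exact .inl (by simpa [hg] using ρ.inv_self_apply g u)
    · exact .inr (by simpa [hg, neg_eq_iff_eq_neg] using ρ.inv_self_apply g u)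

-- For an involution `t`, invariance gives `⟪u, ρ t u⟫ = ⟪ρ t u, u⟫`, so that this number is real.
lemma isRealizable_of_involutions [Finite G] [FiniteDimensional ℂ V] {ρ : Representation ℂ G V}
    (hρ : ρ.IsIrreducible) {u : V} (hu : u ≠ 0)
    (h : ∀ g, ∃ k ∈ signStabilizer ρ u, g * k * (g * k) = 1) : IsRealizable ρ := by
  obtain ⟨c, hinv⟩ := exists_invariant_inner ρ
  let _ : NormedAddCommGroup V := c.toNormedAddCommGroup
  let _ : InnerProductSpace ℂ V := .ofCore c.toCore
  replace hinv : ∀ g x y, ⟪ρ g x, ρ g y⟫_ℂ = ⟪x, y⟫_ℂ := hinv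
  refine isRealizable_of_inner_orbit_im_eq_zero hinv hρ hu fun g => ?_
  obtain ⟨k, hk, hgk⟩ := h g
  have inner_real : (⟪u, ρ (g * k) u⟫_ℂ).im = 0 := by
    have hsymm := hinv (g * k) u (ρ (g * k) u)
    rw [← Module.End.mul_apply, ← map_mul, hgk, map_one, Module.End.one_apply] at hsymm
    rw [← Complex.conj_eq_iff_im, inner_conj_symm, hsymm]
  rw [map_mul, Module.End.mul_apply] at inner_real
  rcases hk with hk | hk <;> simpa [hk] using inner_real

end Signs

lemma isIrreducible_of_equiv {k V W : Type*} [Field k] [AddCommGroup V] [Module k V]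
    [AddCommGroup W] [Module k W] {ρ : Representation k G V} {σ : Representation k G W}
    (f : ρ.Equiv σ) (hσ : σ.IsIrreducible) : ρ.IsIrreducible := by
  rw [Representation.irreducible_iff_isSimpleModule_asModule] at hσ ⊢
  exact IsSimpleModule.congr (LinearEquiv.ofBijective
    (Representation.IntertwiningMap.equivLinearMapAsModule _ _ f.toIntertwiningMap)
    f.toLinearEquiv.bijective)

lemma exists_irrepList_hasRealEntries [Finite G]
    (h : ∀ (n : ℕ) (Δ : G →* Matrix (Fin n) (Fin n) ℂ), (matRep Δ).IsIrreducible →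
      IsRealizable (matRep Δ)) :
    ∃ (r : ℕ) (A : IrrepList G r), ∀ p, HasRealEntries (A.Γ p) := by
  let X := {F : Σ d : ℕ, G →* Matrix (Fin d) (Fin d) ℂ // (matRep F.2).IsIrreducible ∧
    (∀ g, F.2 g ∈ Matrix.unitaryGroup (Fin F.1) ℂ) ∧ HasRealEntries F.2}
  let S : Setoid X :=
    { r := fun F F' => Nonempty ((matRep F.1.2).Equiv (matRep F'.1.2))
      iseqv := ⟨fun _ => ⟨.refl _⟩, fun ⟨f⟩ => ⟨f.symm⟩, fun ⟨f⟩ ⟨f'⟩ => ⟨f.trans f'⟩⟩ }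
  have out_injective (p q : Quotient S)
      (hpq : Nonempty ((matRep p.out.1.2).Equiv (matRep q.out.1.2))) : p = q := by
    rw [← p.out_eq, ← q.out_eq]
    exact Quotient.sound hpq
  have : Finite (Quotient S) :=
    finite_of_inequivalent (Λ := fun p : Quotient S => p.out.1.2) (fun p => p.out.2.1)
      out_injective
  let e := Finite.equivFin (Quotient S)
  refine ⟨_, ⟨_, fun p => (e.symm p).out.1.2, fun p => (e.symm p).out.2.2.1,
    fun p => (e.symm p).out.2.1, fun p q hpq => e.symm.injective (out_injective _ _ hpq), ?_⟩,
    fun p => (e.symm p).out.2.2.2⟩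
  intro n Δ hΔ
  obtain ⟨d, Γ, hunitary, hreal, ⟨f⟩⟩ := h n Δ hΔ
  let F : X := ⟨⟨d, Γ⟩, isIrreducible_of_equiv f hΔ, hunitary, hreal⟩
  obtain ⟨f'⟩ : Nonempty ((matRep (Quotient.out ⟦F⟧).1.2).Equiv (matRep F.1.2)) :=
    Quotient.mk_out F
  exact ⟨e ⟦F⟧, by rw [e.symm_apply_apply]; exact ⟨f'.trans f⟩⟩

end Realizability

/-! ### Rotations and the functions on the sphere -/

section OrthogonalMatrices

variable {ι : Type*} [Fintype ι] [DecidableEq ι]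

/-- The orthogonal matrix of a linear isometry in the standard basis. -/
noncomputable def orthogonalMatrix :
    (EuclideanSpace ℝ ι ≃ₗᵢ[ℝ] EuclideanSpace ℝ ι) ≃* Matrix.orthogonalGroup ι ℝ :=
  let e := (Matrix.toEuclideanCLM (n := ι) (𝕜 := ℝ)).symm
  Unitary.linearIsometryEquiv.symm.trans
    (Unitary.mapEquiv ⟨e.toRingEquiv.toMulEquiv, e.map_star'⟩).toMulEquiv

lemma toEuclideanCLM_orthogonalMatrix (g : EuclideanSpace ℝ ι ≃ₗᵢ[ℝ] EuclideanSpace ℝ ι) :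
    Matrix.toEuclideanCLM (𝕜 := ℝ) (orthogonalMatrix g : Matrix ι ι ℝ) =
      g.toContinuousLinearEquiv :=
  StarAlgEquiv.apply_symm_apply _ _

lemma orthogonalMatrix_mulVec (g : EuclideanSpace ℝ ι ≃ₗᵢ[ℝ] EuclideanSpace ℝ ι)
    (x : EuclideanSpace ℝ ι) : (orthogonalMatrix g : Matrix ι ι ℝ).mulVec x.ofLp = (g x).ofLp := by
  rw [← Matrix.ofLp_toEuclideanCLM, toEuclideanCLM_orthogonalMatrix]
  rfl

lemma apply_eq_sum (g : EuclideanSpace ℝ ι ≃ₗᵢ[ℝ] EuclideanSpace ℝ ι) (x : EuclideanSpace ℝ ι)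
    (i : ι) : g x i = ∑ j, (orthogonalMatrix g : Matrix ι ι ℝ) i j * x j :=
  (congrFun (orthogonalMatrix_mulVec g x) i).symm

lemma det_orthogonalMatrix (g : EuclideanSpace ℝ ι ≃ₗᵢ[ℝ] EuclideanSpace ℝ ι) :
    (orthogonalMatrix g : Matrix ι ι ℝ).det =
      LinearMap.det (g.toLinearEquiv : EuclideanSpace ℝ ι →ₗ[ℝ] EuclideanSpace ℝ ι) :=
  (congrArg Matrix.det rfl).trans (LinearMap.det_toMatrix (EuclideanSpace.basisFun ι ℝ).toBasis _)

end OrthogonalMatrices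

section Conjugation

variable {α R : Type*} [MeasurableSpace α] {μ : Measure α} [NormedAddCommGroup R] [StarAddMonoid R]
  [NormedStarGroup R] {p : ENNReal}

noncomputable instance : StarAddMonoid (Lp R p μ) where
  star_add f h := by
    refine Lp.ext ?_
    filter_upwards [Lp.coeFn_star (f + h), Lp.coeFn_add f h, Lp.coeFn_add (star f) (star h),
      Lp.coeFn_star f, Lp.coeFn_star h] with x h₁ h₂ h₃ h₄ h₅
    simp only [h₁, h₂, h₃, h₄, h₅, Pi.star_apply, Pi.add_apply, star_add]

instance {𝕜 : Type*} [NormedRing 𝕜] [Star 𝕜] [Module 𝕜 R] [IsBoundedSMul 𝕜 R] [StarModule 𝕜 R] :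
    StarModule 𝕜 (Lp R p μ) where
  star_smul c f := by
    refine Lp.ext ?_
    filter_upwards [Lp.coeFn_star (c • f), Lp.coeFn_smul c f, Lp.coeFn_smul (star c) (star f),
      Lp.coeFn_star f] with x h₁ h₂ h₃ h₄
    simp only [h₁, h₂, h₃, h₄, Pi.star_apply, Pi.smul_apply, star_smul]

open scoped InnerProductSpace in
lemma inner_star_star {𝕜 : Type*} [RCLike 𝕜] (f h : Lp 𝕜 2 μ) :
    ⟪star f, star h⟫_𝕜 = star ⟪f, h⟫_𝕜 := by
  rw [L2.inner_def, L2.inner_def, ← starRingEnd_apply, ← integral_conj]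
  refine integral_congr_ae ?_
  filter_upwards [Lp.coeFn_star f, Lp.coeFn_star h] with x h₁ h₂
  simp only [h₁, h₂, Pi.star_apply, RCLike.inner_apply, map_mul, starRingEnd_apply, star_star]

lemma isRealValued_iff {f : L2S} : IsRealValued f ↔ star f = f := by
  have hf := Lp.coeFn_star f
  refine ⟨fun h => Lp.ext ?_, fun h => ?_⟩
  · filter_upwards [h, hf] with x h₁ h₂
    rw [h₂]
    exact Complex.conj_eq_iff_im.mpr h₁
  · rw [h] at hf
    filter_upwards [hf] with x hx
    exact Complex.conj_eq_iff_im.mp hx.symm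

end Conjugation

section Action

open scoped Pointwise

lemma continuous_actS (g : E3 ≃ₗᵢ[ℝ] E3) : Continuous (actS g) :=
  Continuous.subtype_mk (g.continuous.comp continuous_subtype_val) _

lemma actS_mul (g h : E3 ≃ₗᵢ[ℝ] E3) (x : S2) : actS (g * h) x = actS g (actS h x) := rfl

-- The surface measure of `s` is that of the cone over `s`, up to a factor.
lemma measurePreserving_actS (g : E3 ≃ₗᵢ[ℝ] E3) : MeasurePreserving (actS g) surface surface := by
  refine ⟨(continuous_actS g).measurable, Measure.ext fun s hs => ?_⟩
  have cone_preimage : (Set.Ioo (0 : ℝ) 1 • ((↑) '' (actS g ⁻¹' s) : Set E3)) =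
      g ⁻¹' (Set.Ioo (0 : ℝ) 1 • ((↑) '' s : Set E3)) := by
    ext x
    simp only [Set.mem_smul, Set.mem_image, Set.mem_preimage]
    constructor
    · rintro ⟨r, hr, _, ⟨y, hy, rfl⟩, rfl⟩
      exact ⟨r, hr, _, ⟨_, hy, rfl⟩, (map_smul g r (y : E3)).symm⟩
    · rintro ⟨r, hr, _, ⟨y, hy, rfl⟩, hx⟩
      refine ⟨r, hr, _, ⟨actS g⁻¹ y, ?_, rfl⟩, g.injective ?_⟩
      · rwa [← actS_mul, mul_inv_cancel]
      · rw [map_smul, ← hx]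
        exact congrArg (r • ·) (g.apply_symm_apply y)
  rw [Measure.map_apply (continuous_actS g).measurable hs, Measure.toSphere_apply' _ hs,
    Measure.toSphere_apply' _ ((continuous_actS g).measurable hs), cone_preimage]
  exact congrArg _ (g.measurePreserving.measure_preimage_equiv
    (f := g.toHomeomorph.toMeasurableEquiv) _)

lemma coeFn_compMeasurePreserving_actS (g : E3 ≃ₗᵢ[ℝ] E3) (f : L2S) :
    Lp.compMeasurePreserving (actS g) (measurePreserving_actS g) f =ᵐ[surface] f ∘ actS g :=
  Lp.coeFn_compMeasurePreserving f (measurePreserving_actS g)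

/-- The unitary operators `f ↦ f ∘ g⁻¹`. -/
noncomputable def translate : (E3 ≃ₗᵢ[ℝ] E3) →* (L2S →ₗᵢ[ℂ] L2S) where
  toFun g := Lp.compMeasurePreservingₗᵢ ℂ (actS g⁻¹) (measurePreserving_actS g⁻¹)
  map_one' := LinearIsometry.ext fun f => Lp.ext
    (Lp.coeFn_compMeasurePreserving f (measurePreserving_actS 1⁻¹))
  map_mul' g h := by
    refine LinearIsometry.ext fun f => Lp.ext ?_
    filter_upwards [coeFn_compMeasurePreserving_actS (g * h)⁻¹ f,
      coeFn_compMeasurePreserving_actS g⁻¹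
        (Lp.compMeasurePreserving (actS h⁻¹) (measurePreserving_actS h⁻¹) f),
      (measurePreserving_actS g⁻¹).quasiMeasurePreserving.ae
        (coeFn_compMeasurePreserving_actS h⁻¹ f)] with x h₁ h₂ h₃
    exact h₁.trans (h₂.trans h₃).symm

lemma coeFn_translate (g : E3 ≃ₗᵢ[ℝ] E3) (f : L2S) :
    translate g f =ᵐ[surface] fun x => f (actS g⁻¹ x) :=
  coeFn_compMeasurePreserving_actS g⁻¹ f

lemma translate_star (g : E3 ≃ₗᵢ[ℝ] E3) (f : L2S) :
    translate g (star f) = star (translate g f) := by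
  refine Lp.ext ?_
  filter_upwards [coeFn_translate g f, coeFn_translate g (star f), Lp.coeFn_star (translate g f),
    (measurePreserving_actS g⁻¹).quasiMeasurePreserving.ae (Lp.coeFn_star f)] with x h₁ h₂ h₃ h₄
  rw [h₂, h₃, h₄, Pi.star_apply, Pi.star_apply, h₁]

end Action

/-! ### Harmonic polynomials -/

section Polynomials

open MvPolynomial

variable {σ R : Type*} [CommRing R]

lemma pderiv_comm (i j : σ) (P : MvPolynomial σ R) :
    pderiv i (pderiv j P) = pderiv j (pderiv i P) := by
  classical
  have h : ⁅pderiv (R := R) i, pderiv (R := R) j⁆ = 0 := by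
    refine MvPolynomial.derivation_ext fun k => ?_
    simp only [Derivation.commutator_apply, pderiv_X, Derivation.coe_zero, Pi.zero_apply,
      Pi.single_apply]
    split_ifs <;> simp
  simpa [Derivation.commutator_apply, sub_eq_zero] using DFunLike.congr_fun h P

lemma derivation_aeval [Fintype σ] {A M : Type*} [CommRing A] [Algebra R A] [AddCommGroup M]
    [Module A M] [Module R M] (D : Derivation R A M) (f : σ → A) (P : MvPolynomial σ R) :
    D (aeval f P) = ∑ j, aeval f (pderiv j P) • D (f j) := by
  classical
  induction P using MvPolynomial.induction_on with
  | C a => simp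
  | add p q hp hq => simp [hp, hq, add_smul, Finset.sum_add_distrib]
  | mul_X p n hp =>
    simp [pderiv_X, hp, Pi.single_apply, add_smul, mul_smul, Finset.sum_add_distrib,
      Finset.smul_sum, apply_ite (aeval f), ite_smul]

lemma hasDerivAt_eval [Fintype σ] {𝕜 A : Type*} [NontriviallyNormedField 𝕜] [NormedCommRing A]
    [NormedAlgebra 𝕜 A] (P : MvPolynomial σ A) {γ : 𝕜 → σ → A} {γ' : σ → A} {t : 𝕜}
    (hγ : ∀ i, HasDerivAt (fun s => γ s i) (γ' i) t) :
    HasDerivAt (fun s => eval (γ s) P) (∑ i, eval (γ t) (pderiv i P) * γ' i) t := by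
  classical
  induction P using MvPolynomial.induction_on with
  | C a => simpa using hasDerivAt_const t a
  | add p q hp hq => simpa [add_mul, Finset.sum_add_distrib] using hp.fun_add hq
  | mul_X p n hp =>
    simp only [map_mul, eval_X]
    refine (hp.fun_mul (hγ n)).congr_deriv ?_
    simp [pderiv_X, Pi.single_apply, add_mul, Finset.sum_add_distrib, Finset.sum_mul,
      apply_ite (eval (γ t)), mul_right_comm, mul_comm (γ t n), add_comm]

/-- The infinitesimal rotation in the plane of the coordinates `i` and `j`. -/
noncomputable def rotGen (i j : σ) : Derivation R (MvPolynomial σ R) (MvPolynomial σ R) :=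
  (X i : MvPolynomial σ R) • pderiv j - (X j : MvPolynomial σ R) • pderiv i

lemma rotGen_apply (i j : σ) (P : MvPolynomial σ R) :
    rotGen i j P = X i * pderiv j P - X j * pderiv i P := rfl

lemma rotGen_self (i : σ) : rotGen (R := R) i i = 0 := sub_self _

lemma rotGen_rotGen [DecidableEq σ] (i j : σ) (P : MvPolynomial σ R) :
    rotGen i j (rotGen i j P) = X i ^ 2 * pderiv j (pderiv j P) + X j ^ 2 * pderiv i (pderiv i P) -
      2 * (X i * X j * pderiv i (pderiv j P)) - X i * pderiv i P - X j * pderiv j P +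
      if i = j then 2 * (X i * pderiv i P) else 0 := by
  split_ifs with h
  · subst h
    rw [rotGen_self]
    simp only [Derivation.coe_zero, Pi.zero_apply]
    ring
  · simp only [rotGen_apply, map_sub, pderiv_mul, pderiv_X_self, pderiv_X_of_ne h,
      pderiv_X_of_ne (Ne.symm h), pderiv_comm j i]
    ring

lemma eval_mul_of_isHomogeneous {l : ℕ} {P : MvPolynomial σ R} (hP : P.IsHomogeneous l)
    (c : R) (v : σ → R) : eval (fun i => c * v i) P = c ^ l * eval v P := by
  rw [eval_eq, eval_eq, Finset.mul_sum]
  refine Finset.sum_congr rfl fun m hm => ?_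
  simp only [mul_pow, Finset.prod_mul_distrib, Finset.prod_pow_eq_pow_sum,
    ← hP.degree_eq_sum_deg_support hm]
  ring

variable [Fintype σ]

/-- The Laplace operator on polynomials. -/
noncomputable def laplacian : MvPolynomial σ R →ₗ[R] MvPolynomial σ R :=
  ∑ i, (pderiv i).toLinearMap ∘ₗ (pderiv i).toLinearMap

lemma laplacian_apply (P : MvPolynomial σ R) : laplacian P = ∑ i, pderiv i (pderiv i P) := by
  simp [laplacian]

lemma sum_sum_X_mul_X_mul_pderiv_pderiv {l : ℕ} {P : MvPolynomial σ R} (hP : P.IsHomogeneous l) :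
    ∑ i, ∑ j, X i * X j * pderiv i (pderiv j P) = (l : MvPolynomial σ R) * (l - 1) * P := by
  have euler (j : σ) : ∑ i, X i * X j * pderiv i (pderiv j P) =
      ((l - 1 : ℕ) : MvPolynomial σ R) * (X j * pderiv j P) := by
    rw [← mul_left_comm, ← nsmul_eq_mul, ← (hP.pderiv (i := j)).sum_X_mul_pderiv, Finset.mul_sum]
    exact Finset.sum_congr rfl fun i _ => by ring
  rw [Finset.sum_comm, Finset.sum_congr rfl fun j _ => euler j, ← Finset.mul_sum,
    hP.sum_X_mul_pderiv, nsmul_eq_mul]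
  rcases l with - | l <;> push_cast <;> ring_nf

-- The squared angular momentum: its eigenvalue separates the degrees.
lemma sum_rotGen_rotGen {l : ℕ} {P : MvPolynomial σ R} (hP : P.IsHomogeneous l)
    (hΔ : laplacian P = 0) :
    ∑ i, ∑ j, rotGen i j (rotGen i j P) =
      -(2 * l * (l + Fintype.card σ - 2) : MvPolynomial σ R) * P := by
  classical
  rw [laplacian_apply] at hΔ
  have euler := hP.sum_X_mul_pderiv
  rw [nsmul_eq_mul] at euler
  have euler₂ := sum_sum_X_mul_X_mul_pderiv_pderiv hP
  simp only [rotGen_rotGen, Finset.sum_add_distrib, Finset.sum_sub_distrib, Finset.sum_const,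
    Finset.sum_ite_eq, Finset.mem_univ, if_true, Finset.card_univ, nsmul_eq_mul]
  simp only [← Finset.mul_sum, ← Finset.sum_mul, hΔ, euler, euler₂]
  ring

lemma laplacian_map {S : Type*} [CommRing S] (φ : R →+* S) (P : MvPolynomial σ R) :
    laplacian (map φ P) = map φ (laplacian P) := by
  simp only [laplacian_apply, pderiv_map, map_sum]

lemma laplacian_isHomogeneous {l : ℕ} {P : MvPolynomial σ R} (hP : P.IsHomogeneous (l + 2)) :
    (laplacian P).IsHomogeneous l := by
  rw [laplacian_apply]
  exact IsHomogeneous.sum _ _ _ fun i _ => hP.pderiv.pderiv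

lemma laplacian_eq_zero_of_lt {l : ℕ} (hl : l < 2) {P : MvPolynomial σ R}
    (hP : P.IsHomogeneous l) : laplacian P = 0 := by
  rw [laplacian_apply]
  refine Finset.sum_eq_zero fun i _ => ?_
  have h := hP.pderiv (i := i)
  rw [show l - 1 = 0 by omega, ← totalDegree_zero_iff_isHomogeneous,
    totalDegree_eq_zero_iff_eq_C] at h
  rw [h, pderiv_C]

variable {k : Type*} [CommRing k] [Algebra k R]

/-- The polynomial obtained by applying a matrix to the variables. -/
noncomputable def substMatrix (A : Matrix σ σ k) : MvPolynomial σ R →ₐ[R] MvPolynomial σ R :=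
  aeval fun i => ∑ j, A i j • X j

lemma pderiv_substMatrix (A : Matrix σ σ k) (a : σ) (P : MvPolynomial σ R) :
    pderiv a (substMatrix A P) = ∑ j, A j a • substMatrix A (pderiv j P) := by
  classical
  rw [substMatrix, derivation_aeval]
  refine Finset.sum_congr rfl fun j _ => ?_
  simp [Derivation.map_smul_of_tower, pderiv_X, Pi.single_apply]

lemma laplacian_substMatrix [DecidableEq σ] {A : Matrix σ σ k}
    (hA : A ∈ Matrix.orthogonalGroup σ k) (P : MvPolynomial σ R) :
    laplacian (substMatrix A P) = substMatrix A (laplacian P) := by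
  have rows (i j : σ) : ∑ a, A i a * A j a = if i = j then 1 else 0 := by
    rw [← Matrix.one_apply, ← (Matrix.mem_orthogonalGroup_iff _ _).mp hA, Matrix.mul_apply]
    rfl
  simp only [laplacian_apply, map_sum, pderiv_substMatrix, Derivation.map_smul_of_tower,
    Finset.smul_sum, smul_smul]
  calc ∑ a, ∑ i, ∑ j, (A i a * A j a) • substMatrix A (pderiv j (pderiv i P))
    _ = ∑ i, ∑ j, (∑ a, A i a * A j a) • substMatrix A (pderiv j (pderiv i P)) := by
        simp only [Finset.sum_smul]
        rw [Finset.sum_comm]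
        exact Finset.sum_congr rfl fun i _ => Finset.sum_comm
    _ = ∑ i, substMatrix A (pderiv i (pderiv i P)) := by
        simp only [rows, ite_smul, one_smul, zero_smul, Finset.sum_ite_eq, Finset.mem_univ, if_true]

lemma isHomogeneous_substMatrix (A : Matrix σ σ k) {l : ℕ} {P : MvPolynomial σ R}
    (hP : P.IsHomogeneous l) : (substMatrix A P).IsHomogeneous l := by
  have h := hP.aeval (S := R) (fun i => ∑ j, A i j • X j) (n := 1) fun i =>
    IsHomogeneous.sum _ _ _ fun j _ => by
      rw [← algebraMap_smul R, smul_eq_C_mul]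
      exact isHomogeneous_C_mul_X _ _
  rwa [one_mul] at h

end Polynomials

section PolynomialFunctions

open MvPolynomial

/-- The restriction of a polynomial to the sphere, as a continuous function. -/
noncomputable def polyC : MvPolynomial (Fin 3) ℂ →ₐ[ℂ] C(S2, ℂ) :=
  aeval fun i => ⟨fun x => ((x : E3) i : ℂ), by fun_prop⟩

lemma polyC_apply (P : MvPolynomial (Fin 3) ℂ) (x : S2) :
    polyC P x = eval (fun i => ((x : E3) i : ℂ)) P :=
  comp_aeval_apply (φ := ContinuousMap.evalAlgHom ℂ ℂ x) _ P

lemma polyC_map_conj (P : MvPolynomial (Fin 3) ℂ) (x : S2) :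
    polyC (map (starRingEnd ℂ) P) x = star (polyC P x) := by
  rw [polyC_apply, polyC_apply, eval_map, ← starRingEnd_apply, eval₂_comp]
  simp [Function.comp_def]

lemma polyC_substMatrix (g : E3 ≃ₗᵢ[ℝ] E3) (P : MvPolynomial (Fin 3) ℂ) (x : S2) :
    polyC (substMatrix (orthogonalMatrix g : Matrix (Fin 3) (Fin 3) ℝ) P) x =
      polyC P (actS g x) := by
  rw [polyC_apply P]
  refine (comp_aeval_apply (φ := (ContinuousMap.evalAlgHom ℂ ℂ x).comp polyC) _ P).trans
    (congrArg (fun v => eval v P) (funext fun i => ?_))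
  simp [polyC_apply, actS, apply_eq_sum, ← Complex.coe_smul]

/-- The restriction of a polynomial to the sphere, as a square integrable function. -/
noncomputable def polyL2 : MvPolynomial (Fin 3) ℂ →ₗ[ℂ] L2S :=
  (ContinuousMap.toLp 2 surface ℂ).toLinearMap ∘ₗ polyC.toLinearMap

lemma coeFn_polyL2 (P : MvPolynomial (Fin 3) ℂ) : polyL2 P =ᵐ[surface] polyC P :=
  ContinuousMap.coeFn_toLp surface (polyC P)

open scoped InnerProductSpace in
lemma inner_polyL2 (P Q : MvPolynomial (Fin 3) ℂ) :
    ⟪polyL2 P, polyL2 Q⟫_ℂ = ∫ x, polyC (map (starRingEnd ℂ) P * Q) x ∂surface := by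
  rw [L2.inner_def]
  refine integral_congr_ae ?_
  filter_upwards [coeFn_polyL2 P, coeFn_polyL2 Q] with x h₁ h₂
  rw [h₁, h₂, map_mul, ContinuousMap.mul_apply, polyC_map_conj]
  exact mul_comm _ _

lemma translate_polyL2 (g : E3 ≃ₗᵢ[ℝ] E3) (P : MvPolynomial (Fin 3) ℂ) :
    translate g (polyL2 P) =
      polyL2 (substMatrix (orthogonalMatrix g⁻¹ : Matrix (Fin 3) (Fin 3) ℝ) P) := by
  refine Lp.ext ?_
  filter_upwards [coeFn_translate g (polyL2 P),
    coeFn_polyL2 (substMatrix (orthogonalMatrix g⁻¹ : Matrix (Fin 3) (Fin 3) ℝ) P),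
    (measurePreserving_actS g⁻¹).quasiMeasurePreserving.ae (coeFn_polyL2 P)] with x h₁ h₂ h₃
  rw [h₁, h₂, h₃, polyC_substMatrix]

lemma star_polyL2 (P : MvPolynomial (Fin 3) ℂ) :
    star (polyL2 P) = polyL2 (map (starRingEnd ℂ) P) := by
  refine Lp.ext ?_
  filter_upwards [Lp.coeFn_star (polyL2 P), coeFn_polyL2 (map (starRingEnd ℂ) P),
    coeFn_polyL2 P] with x h₁ h₂ h₃
  rw [h₁, h₂, Pi.star_apply, h₃, polyC_map_conj]

lemma polyL2_eq_zero_iff {P : MvPolynomial (Fin 3) ℂ} : polyL2 P = 0 ↔ polyC P = 0 :=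
  map_eq_zero_iff _ (ContinuousMap.toLp_injective (p := 2) (𝕜 := ℂ) (E := ℂ) surface)

lemma eq_zero_of_polyC_eq_zero {l : ℕ} {P : MvPolynomial (Fin 3) ℂ} (hP : P.IsHomogeneous l)
    (h : polyC P = 0) : P = 0 := by
  have infinite_pos : (Complex.ofReal '' Set.Ioi (0 : ℝ)).Infinite :=
    (Set.Ioi_infinite 0).image Complex.ofReal_injective.injOn
  refine funext_set (fun _ => Complex.ofReal '' Set.Ioi (0 : ℝ)) (fun _ => infinite_pos)
    fun v hv => ?_
  choose r hr hrv using fun i => hv i (Set.mem_univ i)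
  let y : E3 := WithLp.toLp 2 r
  have norm_ne : ‖y‖ ≠ 0 :=
    norm_ne_zero_iff.mpr fun h0 => (hr 0).ne' (congrArg (fun z : E3 => z 0) h0)
  let x : S2 := ⟨‖y‖⁻¹ • y, by
    rw [mem_sphere_zero_iff_norm, norm_smul, norm_inv, norm_norm, inv_mul_cancel₀ norm_ne]⟩
  have v_eq : v = fun i => (‖y‖ : ℂ) * ((x : E3) i : ℂ) := by
    funext i
    rw [← hrv i, ← Complex.ofReal_mul]
    exact congrArg Complex.ofReal (mul_inv_cancel_left₀ norm_ne (r i)).symm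
  rw [v_eq, eval_mul_of_isHomogeneous hP, ← polyC_apply, h, ContinuousMap.zero_apply, mul_zero,
    map_zero]

end PolynomialFunctions

section PlaneRotations

open MvPolynomial

section EuclideanSpace

variable {ι : Type*} [Fintype ι] [DecidableEq ι] {i j : ι}

/-- The rotation by the angle `θ` in the plane of the coordinates `i` and `j`. -/
noncomputable def planeRotation (hij : i ≠ j) (θ : ℝ) :
    EuclideanSpace ℝ ι →ₗᵢ[ℝ] EuclideanSpace ℝ ι where
  toFun x := WithLp.toLp 2 fun k =>
    if k = i then Real.cos θ * x i - Real.sin θ * x j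
    else if k = j then Real.sin θ * x i + Real.cos θ * x j
    else x k
  map_add' x y := by
    ext k
    simp only [PiLp.add_apply]
    split_ifs <;> ring
  map_smul' c x := by
    ext k
    simp only [PiLp.smul_apply, smul_eq_mul, RingHom.id_apply]
    split_ifs <;> ring
  norm_map' x := by
    rw [← sq_eq_sq₀ (norm_nonneg _) (norm_nonneg _), EuclideanSpace.real_norm_sq_eq,
      EuclideanSpace.real_norm_sq_eq, ← sub_eq_zero, ← Finset.sum_sub_distrib,
      Fintype.sum_eq_add i j hij fun k hk => by simp [hk.1, hk.2]]
    simp only [LinearMap.coe_mk, AddHom.coe_mk, if_true, if_neg hij.symm]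
    linear_combination (x i ^ 2 + x j ^ 2) * Real.sin_sq_add_cos_sq θ

lemma planeRotation_apply (hij : i ≠ j) (θ : ℝ) (x : EuclideanSpace ℝ ι) (k : ι) :
    planeRotation hij θ x k =
      if k = i then Real.cos θ * x i - Real.sin θ * x j
      else if k = j then Real.sin θ * x i + Real.cos θ * x j
      else x k := rfl

lemma planeRotation_zero (hij : i ≠ j) : planeRotation hij 0 = LinearIsometry.id := by
  ext x k
  rw [planeRotation_apply]
  split_ifs with hi hj <;> simp_all

lemma hasDerivAt_planeRotation (hij : i ≠ j) (x : EuclideanSpace ℝ ι) (k : ι) (θ : ℝ) :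
    HasDerivAt (fun θ => planeRotation hij θ x k)
      (if k = i then -planeRotation hij θ x j else if k = j then planeRotation hij θ x i else 0)
      θ := by
  simp only [planeRotation_apply, if_true, if_neg hij.symm]
  split_ifs
  · refine (((Real.hasDerivAt_cos θ).mul_const (x i)).fun_sub
      ((Real.hasDerivAt_sin θ).mul_const (x j))).congr_deriv ?_
    ring
  · refine (((Real.hasDerivAt_sin θ).mul_const (x i)).fun_add
      ((Real.hasDerivAt_cos θ).mul_const (x j))).congr_deriv ?_
    ring
  · exact hasDerivAt_const _ _

end EuclideanSpace

variable {i j : Fin 3}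

/-- The action of `planeRotation hij θ` on the sphere. -/
noncomputable def rotateS (hij : i ≠ j) (θ : ℝ) : S2 → S2 :=
  actS ((planeRotation hij θ).toLinearIsometryEquiv rfl)

lemma coe_rotateS (hij : i ≠ j) (θ : ℝ) (x : S2) :
    (rotateS hij θ x : E3) = planeRotation hij θ (x : E3) := rfl

lemma rotateS_zero (hij : i ≠ j) (x : S2) : rotateS hij 0 x = x :=
  Subtype.ext (congrArg (fun g : E3 →ₗᵢ[ℝ] E3 => g x) (planeRotation_zero hij))

lemma hasDerivAt_polyC_rotateS (hij : i ≠ j) (P : MvPolynomial (Fin 3) ℂ) (x : S2) (θ : ℝ) :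
    HasDerivAt (fun θ => polyC P (rotateS hij θ x)) (polyC (rotGen i j P) (rotateS hij θ x)) θ := by
  simp only [polyC_apply, coe_rotateS]
  refine (hasDerivAt_eval P fun k =>
    (hasDerivAt_planeRotation hij (x : E3) k θ).ofReal_comp).congr_deriv ?_
  rw [Fintype.sum_eq_add i j hij fun k hk => by simp [hk.1, hk.2], rotGen_apply]
  simp only [if_true, if_neg hij.symm, map_sub, map_mul, eval_X, Complex.ofReal_neg]
  ring

lemma integral_polyC_rotateS (hij : i ≠ j) (P : MvPolynomial (Fin 3) ℂ) (θ : ℝ) :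
    ∫ x, polyC P (rotateS hij θ x) ∂surface = ∫ x, polyC P x ∂surface := by
  have h := measurePreserving_actS ((planeRotation hij θ).toLinearIsometryEquiv rfl)
  conv_rhs => rw [← h.map_eq, integral_map h.measurable.aemeasurable
    (polyC P).continuous.aestronglyMeasurable]
  rfl

-- The integral over the sphere of a rotated function does not depend on the angle of the rotation.
lemma integral_rotGen (i j : Fin 3) (P : MvPolynomial (Fin 3) ℂ) :
    ∫ x, polyC (rotGen i j P) x ∂surface = 0 := by
  obtain rfl | hij := eq_or_ne i j
  · simp [rotGen_self]
  have continuous_rotate (Q : MvPolynomial (Fin 3) ℂ) (θ : ℝ) :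
      Continuous fun x => polyC Q (rotateS hij θ x) :=
    (polyC Q).continuous.comp (continuous_actS _)
  have hasDerivAt_integral := (hasDerivAt_integral_of_dominated_loc_of_deriv_le
    (μ := surface) (x₀ := (0 : ℝ)) (s := Set.univ) (bound := fun _ => ‖polyC (rotGen i j P)‖)
    Filter.univ_mem (.of_forall fun θ => (continuous_rotate P θ).aestronglyMeasurable)
    ((continuous_rotate P 0).integrable_of_hasCompactSupport (.of_compactSpace _))
    (continuous_rotate _ 0).aestronglyMeasurable
    (.of_forall fun x θ _ => ContinuousMap.norm_coe_le_norm _ _) (integrable_const _)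
    (.of_forall fun x θ _ => hasDerivAt_polyC_rotateS hij P x θ)).2
  simp only [integral_polyC_rotateS, rotateS_zero] at hasDerivAt_integral
  exact hasDerivAt_integral.unique (hasDerivAt_const _ _)

end PlaneRotations

section SphericalHarmonics

open MvPolynomial
open scoped InnerProductSpace

/-- The harmonic homogeneous polynomials of degree `l`. -/
noncomputable def harmonicPolys (l : ℕ) : Submodule ℂ (MvPolynomial (Fin 3) ℂ) :=
  homogeneousSubmodule (Fin 3) ℂ l ⊓ LinearMap.ker laplacian

lemma mem_harmonicPolys {l : ℕ} {P : MvPolynomial (Fin 3) ℂ} :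
    P ∈ harmonicPolys l ↔ P.IsHomogeneous l ∧ laplacian P = 0 := Iff.rfl

/-- The space of spherical harmonics of degree `l`. -/
noncomputable def harmonicSpace (l : ℕ) : Submodule ℂ L2S := (harmonicPolys l).map polyL2

lemma mem_harmonicSpace {l : ℕ} {f : L2S} : f ∈ harmonicSpace l ↔ IsSphericalHarmonic l f := by
  simp only [harmonicSpace, Submodule.mem_map, mem_harmonicPolys, IsSphericalHarmonic, and_assoc,
    laplacian_apply]
  refine exists_congr fun P => and_congr_right fun _ => and_congr_right fun _ => ?_
  rw [eq_comm, Lp.ext_iff]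
  simp only [← polyC_apply]
  exact (coeFn_polyL2 P).congr_right

instance (l : ℕ) : FiniteDimensional ℂ (homogeneousSubmodule (Fin 3) ℂ l) :=
  Module.Finite.of_fg (homogeneousSubmodule_fg _ _ l)

instance (l : ℕ) : FiniteDimensional ℂ (harmonicSpace l) :=
  have : FiniteDimensional ℂ (harmonicPolys l) := Submodule.finiteDimensional_of_le inf_le_left
  inferInstanceAs (FiniteDimensional ℂ ((harmonicPolys l).map polyL2))

lemma translate_mem_harmonicSpace (g : E3 ≃ₗᵢ[ℝ] E3) {l : ℕ} {f : L2S} (hf : f ∈ harmonicSpace l) :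
    translate g f ∈ harmonicSpace l := by
  obtain ⟨P, ⟨hP, hΔ⟩, rfl⟩ := hf
  rw [translate_polyL2]
  refine ⟨_, ⟨isHomogeneous_substMatrix _ hP, ?_⟩, rfl⟩
  exact (laplacian_substMatrix (orthogonalMatrix g⁻¹).2 P).trans
    ((congrArg _ hΔ).trans (map_zero _))

lemma star_mem_harmonicSpace {l : ℕ} {f : L2S} (hf : f ∈ harmonicSpace l) :
    star f ∈ harmonicSpace l := by
  obtain ⟨P, ⟨hP, hΔ⟩, rfl⟩ := hf
  rw [star_polyL2]
  exact ⟨_, ⟨hP.map _, (laplacian_map _ P).trans ((congrArg _ hΔ).trans (map_zero _))⟩, rfl⟩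

lemma inner_polyL2_rotGen_left (i j : Fin 3) (P Q : MvPolynomial (Fin 3) ℂ) :
    ⟪polyL2 (rotGen i j P), polyL2 Q⟫_ℂ = -⟪polyL2 P, polyL2 (rotGen i j Q)⟫_ℂ := by
  have inner_one (R S : MvPolynomial (Fin 3) ℂ) :
      ⟪polyL2 R, polyL2 S⟫_ℂ = ⟪polyL2 1, polyL2 (map (starRingEnd ℂ) R * S)⟫_ℂ := by
    simp only [inner_polyL2, map_one, one_mul]
  have leibniz : map (starRingEnd ℂ) (rotGen i j P) * Q + map (starRingEnd ℂ) P * rotGen i j Q =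
      rotGen i j (map (starRingEnd ℂ) P * Q) := by
    simp only [rotGen_apply, pderiv_mul, pderiv_map, map_sub, map_mul, map_X]
    ring
  rw [← add_eq_zero_iff_eq_neg, inner_one, inner_one P, ← inner_add_right, ← map_add, leibniz,
    inner_polyL2, map_one, one_mul, integral_rotGen]

lemma sum_polyL2_rotGen_rotGen {l : ℕ} {P : MvPolynomial (Fin 3) ℂ} (hP : P ∈ harmonicPolys l) :
    ∑ i, ∑ j, polyL2 (rotGen i j (rotGen i j P)) = (-(2 * l * (l + 1) : ℕ) : ℂ) • polyL2 P := by
  simp only [← map_sum, sum_rotGen_rotGen hP.1 hP.2]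
  rw [← map_smul, smul_eq_C_mul]
  congr 2
  simp only [Fintype.card_fin, map_neg, map_natCast]
  push_cast
  ring

lemma inner_eq_zero_of_ne {l m : ℕ} (hlm : l ≠ m) {f h : L2S} (hf : f ∈ harmonicSpace l)
    (hh : h ∈ harmonicSpace m) : ⟪f, h⟫_ℂ = 0 := by
  obtain ⟨P, hP, rfl⟩ := hf
  obtain ⟨Q, hQ, rfl⟩ := hh
  have self_adjoint : ⟪∑ i, ∑ j, polyL2 (rotGen i j (rotGen i j P)), polyL2 Q⟫_ℂ =
      ⟪polyL2 P, ∑ i, ∑ j, polyL2 (rotGen i j (rotGen i j Q))⟫_ℂ := by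
    simp only [sum_inner, inner_sum, inner_polyL2_rotGen_left, neg_neg]
  rw [sum_polyL2_rotGen_rotGen hP, sum_polyL2_rotGen_rotGen hQ, inner_smul_left, inner_smul_right,
    map_neg, Complex.conj_natCast] at self_adjoint
  by_contra hne
  have eigenvalue_eq := mul_right_cancel₀ hne self_adjoint
  rw [neg_inj, Nat.cast_inj] at eigenvalue_eq
  rcases hlm.lt_or_gt with h | h <;> nlinarith

lemma polyC_psum_two : polyC (psum (Fin 3) ℂ 2) = 1 := by
  ext x
  have h := EuclideanSpace.real_norm_sq_eq (x : E3)
  rw [norm_eq_of_mem_sphere, one_pow] at h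
  rw [polyC_apply]
  simp only [psum, map_sum, map_pow, eval_X, ContinuousMap.one_apply]
  exact_mod_cast h.symm

lemma polyL2_psum_two_mul (P : MvPolynomial (Fin 3) ℂ) :
    polyL2 (psum (Fin 3) ℂ 2 * P) = polyL2 P :=
  congrArg (ContinuousMap.toLp 2 surface ℂ)
    ((map_mul polyC _ P).trans ((congrArg (· * polyC P) polyC_psum_two).trans (one_mul _)))

lemma isHomogeneous_psum_two_mul {l : ℕ} {P : MvPolynomial (Fin 3) ℂ} (hP : P.IsHomogeneous l) :
    (psum (Fin 3) ℂ 2 * P).IsHomogeneous (l + 2) :=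
  add_comm 2 l ▸ (IsHomogeneous.sum _ _ 2 fun i _ => isHomogeneous_X_pow i 2).mul hP

lemma iSup_harmonicSpace_le_orthogonal {l m : ℕ} (hlm : l < m) :
    ⨆ k ≤ l, harmonicSpace k ≤ (harmonicSpace m)ᗮ :=
  iSup₂_le fun _ hk _ hf => (Submodule.mem_orthogonal _ _).mpr fun _ hh =>
    inner_eq_zero_of_ne (hk.trans_lt hlm).ne' hh hf

lemma eq_zero_of_laplacian_psum_two_mul_eq_zero {l : ℕ} {P : MvPolynomial (Fin 3) ℂ}
    (hP : P.IsHomogeneous l) (hmem : polyL2 P ∈ ⨆ k ≤ l, harmonicSpace k)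
    (hΔ : laplacian (psum (Fin 3) ℂ 2 * P) = 0) : P = 0 := by
  have harmonic : polyL2 P ∈ harmonicSpace (l + 2) :=
    ⟨_, ⟨isHomogeneous_psum_two_mul hP, hΔ⟩, polyL2_psum_two_mul P⟩
  have orthogonal := iSup_harmonicSpace_le_orthogonal (Nat.lt_add_of_pos_right two_pos) hmem
  exact eq_zero_of_polyC_eq_zero hP <| polyL2_eq_zero_iff.mp <| (inner_self_eq_zero (𝕜 := ℂ)).mp <|
    (Submodule.mem_orthogonal _ _).mp orthogonal _ harmonic

lemma exists_laplacian_psum_two_mul_eq {l : ℕ}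
    (hmem : ∀ P : MvPolynomial (Fin 3) ℂ, P.IsHomogeneous l →
      polyL2 P ∈ ⨆ k ≤ l, harmonicSpace k)
    {R : MvPolynomial (Fin 3) ℂ} (hR : R.IsHomogeneous l) :
    ∃ P : MvPolynomial (Fin 3) ℂ, P.IsHomogeneous l ∧ laplacian (psum (Fin 3) ℂ 2 * P) = R := by
  obtain ⟨T, hT⟩ : ∃ T : MvPolynomial (Fin 3) ℂ →ₗ[ℂ] MvPolynomial (Fin 3) ℂ,
      ∀ P, T P = laplacian (psum (Fin 3) ℂ 2 * P) :=
    ⟨laplacian ∘ₗ LinearMap.mulLeft ℂ (psum (Fin 3) ℂ 2), fun _ => rfl⟩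
  have mapsTo (P) (hP : P ∈ homogeneousSubmodule (Fin 3) ℂ l) :
      T P ∈ homogeneousSubmodule (Fin 3) ℂ l := by
    rw [hT]
    exact laplacian_isHomogeneous (isHomogeneous_psum_two_mul hP)
  have injOn : Set.InjOn T (homogeneousSubmodule (Fin 3) ℂ l) := by
    intro P hP Q hQ hPQ
    have hsub := Submodule.sub_mem _ hP hQ
    refine sub_eq_zero.mp (eq_zero_of_laplacian_psum_two_mul_eq_zero hsub (hmem _ hsub) ?_)
    rw [← hT, map_sub, hPQ, sub_self]
  obtain ⟨P, hP, hTP⟩ := (LinearMap.injOn_iff_surjOn mapsTo).mp injOn hR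
  exact ⟨P, hP, (hT P).symm.trans hTP⟩

lemma polyL2_mem_iSup_of_isHomogeneous (l : ℕ) {P : MvPolynomial (Fin 3) ℂ}
    (hP : P.IsHomogeneous l) : polyL2 P ∈ ⨆ k ≤ l, harmonicSpace k := by
  induction l using Nat.strong_induction_on generalizing P with
  | _ l ih =>
  have le_iSup : harmonicSpace l ≤ ⨆ k ≤ l, harmonicSpace k := le_iSup₂_of_le l le_rfl le_rfl
  obtain hl | hl := lt_or_ge l 2
  · exact le_iSup ⟨P, ⟨hP, laplacian_eq_zero_of_lt hl hP⟩, rfl⟩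
  obtain ⟨m, rfl⟩ := Nat.exists_eq_add_of_le' hl
  obtain ⟨Q, hQ, hΔ⟩ := exists_laplacian_psum_two_mul_eq (fun Q => ih m (by lia))
    (laplacian_isHomogeneous hP)
  have harmonic : polyL2 (P - psum (Fin 3) ℂ 2 * Q) ∈ harmonicSpace (m + 2) :=
    ⟨_, ⟨hP.sub (isHomogeneous_psum_two_mul hQ),
      (map_sub laplacian P _).trans (sub_eq_zero.mpr hΔ.symm)⟩, rfl⟩
  have lower : polyL2 Q ∈ ⨆ k ≤ m + 2, harmonicSpace k :=
    biSup_mono (f := harmonicSpace) (fun k (hk : k ≤ m) => hk.trans (Nat.le_add_right m 2)) <|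
      ih m (by lia) hQ
  simpa only [map_sub, polyL2_psum_two_mul, sub_add_cancel] using
    Submodule.add_mem _ (le_iSup harmonic) lower

lemma polyL2_mem_iSup_harmonicSpace (P : MvPolynomial (Fin 3) ℂ) :
    polyL2 P ∈ ⨆ k, harmonicSpace k := by
  rw [← sum_homogeneousComponent P, map_sum]
  refine Submodule.sum_mem _ fun l _ => ?_
  exact iSup₂_le_iSup (· ≤ l) harmonicSpace
    (polyL2_mem_iSup_of_isHomogeneous l (homogeneousComponent_isHomogeneous l P))

lemma denseRange_polyC : DenseRange polyC := by
  let A : StarSubalgebra ℂ C(S2, ℂ) :=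
    { polyC.range with
      star_mem' := by
        rintro _ ⟨P, rfl⟩
        exact ⟨map (starRingEnd ℂ) P, ContinuousMap.ext fun x => polyC_map_conj P x⟩ }
  have separates : A.SeparatesPoints := by
    intro x y hxy
    obtain ⟨i, hi⟩ := Function.ne_iff.mp fun h => hxy (Subtype.ext (PiLp.ext (congrFun h)))
    refine ⟨_, ⟨polyC (X i), ⟨X i, rfl⟩, rfl⟩, ?_⟩
    simpa only [polyC_apply, eval_X, ne_eq, Complex.ofReal_inj] using hi
  intro f
  exact (ContinuousMap.starSubalgebra_topologicalClosure_eq_top_of_separatesPoints A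
    separates).ge (Set.mem_univ f)

lemma topologicalClosure_iSup_harmonicSpace : (⨆ k, harmonicSpace k).topologicalClosure = ⊤ := by
  have dense : DenseRange polyL2 :=
    (ContinuousMap.toLp_denseRange ℂ surface ℂ (p := 2) ENNReal.ofNat_ne_top).comp denseRange_polyC
      (ContinuousMap.toLp 2 surface ℂ).continuous
  rw [← Submodule.dense_iff_topologicalClosure_eq_top]
  exact dense.mono (Set.range_subset_iff.mpr polyL2_mem_iSup_harmonicSpace)

lemma isHilbertSum_harmonicSpace :
    IsHilbertSum ℂ (fun l => harmonicSpace l) fun l => (harmonicSpace l).subtypeₗᵢ :=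
  IsHilbertSum.mkInternal _ (fun _ _ hlm f h => inner_eq_zero_of_ne hlm f.2 h.2)
    topologicalClosure_iSup_harmonicSpace.ge

end SphericalHarmonics

/-! ### Basis functions -/

section BasisFunctions

open scoped InnerProductSpace

variable {G : Subgroup (E3 ≃ₗᵢ[ℝ] E3)} {d e : ℕ} {Γ : G →* Matrix (Fin d) (Fin d) ℂ}
  {Δ : G →* Matrix (Fin e) (Fin e) ℂ} {f : Fin d → L2S}

lemma coeFn_sum_smul (c : Fin d → ℂ) (f : Fin d → L2S) :
    (∑ k, c k • f k : L2S) =ᵐ[surface] fun x => ∑ k, c k * f k x := by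
  filter_upwards [Lp.coeFn_finsetSum Finset.univ fun k => c k • f k,
    ae_all_iff.mpr fun k => Lp.coeFn_smul (c k) (f k)] with x hsum hsmul
  simp only [hsum, Finset.sum_apply, hsmul, Pi.smul_apply, smul_eq_mul]

lemma isBasisFunction_iff : IsBasisFunction Γ f ↔
    ∀ (g : G) j, translate (g : E3 ≃ₗᵢ[ℝ] E3) (f j) = ∑ k, Γ g k j • f k := by
  refine forall_congr' fun g => ae_all_iff.trans (forall_congr' fun j => ?_)
  rw [Lp.ext_iff]
  exact (Filter.EventuallyEq.congr_left (coeFn_translate _ _)).trans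
    (Filter.EventuallyEq.congr_right (coeFn_sum_smul _ _)) |>.symm

lemma IsBasisFunction.mul_inner (hΓ : ∀ g, Γ g ∈ Matrix.unitaryGroup (Fin d) ℂ)
    (hf : IsBasisFunction Γ f) {h : Fin e → L2S} (hh : IsBasisFunction Δ h) (g : G) :
    Γ g * Matrix.of (fun j k => ⟪f j, h k⟫_ℂ) = Matrix.of (fun j k => ⟪f j, h k⟫_ℂ) * Δ g := by
  have invariance : Matrix.of (fun j k => ⟪f j, h k⟫_ℂ) =
      star (Γ g) * (Matrix.of (fun j k => ⟪f j, h k⟫_ℂ) * Δ g) := by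
    ext j k
    rw [Matrix.of_apply, ← (translate (g : E3 ≃ₗᵢ[ℝ] E3)).inner_map_map,
      isBasisFunction_iff.mp hf, isBasisFunction_iff.mp hh]
    simp only [sum_inner, inner_sum, inner_smul_left, inner_smul_right, Matrix.mul_apply,
      Matrix.star_apply, Matrix.of_apply, RCLike.star_def, mul_comm (Δ g _ k), Finset.mul_sum,
      Finset.sum_mul, mul_assoc]
    exact Finset.sum_comm
  conv_lhs => rw [invariance]
  rw [← Matrix.mul_assoc, Matrix.mem_unitaryGroup_iff.mp (hΓ g), Matrix.one_mul]

lemma IsBasisFunction.inner_eq_zero (hΓ : ∀ g, Γ g ∈ Matrix.unitaryGroup (Fin d) ℂ)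
    (hΓi : (matRep Γ).IsIrreducible) (hΔi : (matRep Δ).IsIrreducible)
    (hne : IsEmpty ((matRep Δ).Equiv (matRep Γ))) (hf : IsBasisFunction Γ f) {h : Fin e → L2S}
    (hh : IsBasisFunction Δ h) (j : Fin d) (k : Fin e) : ⟪f j, h k⟫_ℂ = 0 :=
  congrFun₂ (matrix_eq_zero_of_inequivalent hΓi hΔi hne (hf.mul_inner hΓ hh)) j k

lemma IsBasisFunction.inner_apply_apply (hΓ : ∀ g, Γ g ∈ Matrix.unitaryGroup (Fin d) ℂ)
    (hΓi : (matRep Γ).IsIrreducible) (hf : IsBasisFunction Γ f) {h : Fin d → L2S}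
    (hh : IsBasisFunction Γ h) (i j k : Fin d) :
    ⟪f j, h k⟫_ℂ = if j = k then ⟪f i, h i⟫_ℂ else 0 := by
  obtain ⟨c, hc⟩ := exists_eq_smul_one_of_commute hΓi (hf.mul_inner hΓ hh)
  have inner_eq (j k) : ⟪f j, h k⟫_ℂ = if j = k then c else 0 := by
    rw [← Matrix.of_apply (fun j k => ⟪f j, h k⟫_ℂ), hc, Matrix.smul_apply, Matrix.one_apply,
      smul_eq_mul, mul_ite, mul_one, mul_zero]
  rw [inner_eq j k, inner_eq i i, if_pos rfl]

/-- The complex vector space of the basis functions for `Γ`. -/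
noncomputable def basisFunctions (Γ : G →* Matrix (Fin d) (Fin d) ℂ) :
    Submodule ℂ (Fin d → L2S) where
  carrier := {f | IsBasisFunction Γ f}
  add_mem' {f h} hf hh := isBasisFunction_iff.mpr fun g j => by
    simp only [Pi.add_apply, map_add, isBasisFunction_iff.mp hf g j,
      isBasisFunction_iff.mp hh g j, smul_add, Finset.sum_add_distrib]
  zero_mem' := isBasisFunction_iff.mpr fun g j => by simp
  smul_mem' c f hf := isBasisFunction_iff.mpr fun g j => by
    simp only [Pi.smul_apply, map_smul, isBasisFunction_iff.mp hf g j, Finset.smul_sum,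
      smul_comm c]

lemma mem_basisFunctions : f ∈ basisFunctions Γ ↔ IsBasisFunction Γ f := Iff.rfl

lemma IsBasisFunction.eq_of_apply_eq (hΓ : ∀ g, Γ g ∈ Matrix.unitaryGroup (Fin d) ℂ)
    (hΓi : (matRep Γ).IsIrreducible) (hf : IsBasisFunction Γ f) {h : Fin d → L2S}
    (hh : IsBasisFunction Γ h) {i : Fin d} (hi : f i = h i) : f = h := by
  have hfh : IsBasisFunction Γ (f - h) := (basisFunctions Γ).sub_mem hf hh
  refine sub_eq_zero.mp (funext fun j => (inner_self_eq_zero (𝕜 := ℂ)).mp ?_)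
  rw [hfh.inner_apply_apply hΓ hΓi hfh i, if_pos rfl, Pi.sub_apply, hi, sub_self, inner_zero_left]

lemma IsBasisFunction.star (hΓ : HasRealEntries Γ) (hf : IsBasisFunction Γ f) :
    IsBasisFunction Γ fun j => star (f j) :=
  isBasisFunction_iff.mpr fun g j => by
    simp only [translate_star, isBasisFunction_iff.mp hf g j, star_sum, star_smul,
      RCLike.star_def, Complex.conj_eq_iff_im.mpr (hΓ g _ j)]

lemma translate_starProjection (g : E3 ≃ₗᵢ[ℝ] E3) (l : ℕ) (f : L2S) :
    translate g ((harmonicSpace l).starProjection f) =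
      (harmonicSpace l).starProjection (translate g f) := by
  refine (Submodule.eq_starProjection_of_mem_of_inner_eq_zero
    (translate_mem_harmonicSpace g (Submodule.starProjection_apply_mem _ _)) fun h hh => ?_).symm
  have translate_inv : translate g (translate g⁻¹ h) = h := by
    rw [← Function.comp_apply (f := translate g), ← LinearIsometry.coe_mul, ← map_mul,
      mul_inv_cancel, map_one, LinearIsometry.coe_one, id]
  rw [← translate_inv, ← map_sub, (translate g).inner_map_map]
  exact Submodule.starProjection_inner_eq_zero _ _ (translate_mem_harmonicSpace g⁻¹ hh)

lemma IsBasisFunction.starProjection (hf : IsBasisFunction Γ f) (l : ℕ) :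
    IsBasisFunction Γ fun j => (harmonicSpace l).starProjection (f j) :=
  isBasisFunction_iff.mpr fun g j => by
    simp only [translate_starProjection, isBasisFunction_iff.mp hf g j, map_sum, map_smul]

lemma hasSum_starProjection {𝕜 E ι : Type*} [RCLike 𝕜] [NormedAddCommGroup E]
    [InnerProductSpace 𝕜 E] [CompleteSpace E] {V : ι → Submodule 𝕜 E}
    [∀ i, (V i).HasOrthogonalProjection]
    (hV : IsHilbertSum 𝕜 (fun i => V i) fun i => (V i).subtypeₗᵢ) (x : E) :
    HasSum (fun i => (V i).starProjection x) x := by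
  obtain ⟨w, rfl⟩ := hV.surjective_isometry x
  have hsum := hV.OrthogonalFamily.hasSum_linearIsometry w
  have projection_eq (i) :
      (V i).starProjection (hV.OrthogonalFamily.linearIsometry w) = (V i).subtypeₗᵢ (w i) := by
    refine (hsum.map (V i).starProjection (V i).starProjection.continuous).unique ?_
    convert hasSum_single i fun j hj => ?_ using 1
    · exact (Submodule.starProjection_eq_self_iff.mpr (w i).2).symm
    · exact (Submodule.starProjection_apply_eq_zero_iff _).mpr
        ((Submodule.mem_orthogonal' _ _).mpr fun y hy =>
          hV.OrthogonalFamily hj (w j) ⟨y, hy⟩)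
  simpa only [projection_eq] using hsum

/-- The space of the basis functions for `Γ` whose components are spherical harmonics of
degree `l`. -/
noncomputable def harmonicBasisFunctions (Γ : G →* Matrix (Fin d) (Fin d) ℂ) (l : ℕ) :
    Submodule ℂ (Fin d → L2S) :=
  basisFunctions Γ ⊓ Submodule.pi Set.univ fun _ => harmonicSpace l

lemma mem_harmonicBasisFunctions {l : ℕ} : f ∈ harmonicBasisFunctions Γ l ↔
    IsBasisFunction Γ f ∧ ∀ j, f j ∈ harmonicSpace l := by
  simp [harmonicBasisFunctions, mem_basisFunctions, Submodule.mem_pi]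

lemma isotypic_le_topologicalClosure {S : Submodule ℂ L2S}
    (hS : ∀ l, ∀ f ∈ harmonicBasisFunctions Γ l, ∀ j, f j ∈ S) :
    isotypic Γ ≤ S.topologicalClosure := by
  refine Submodule.topologicalClosure_minimal _ (Submodule.span_le.mpr ?_)
    (Submodule.isClosed_topologicalClosure _)
  rintro _ ⟨f, hf, j, rfl⟩
  have projection_mem (l) : (fun j => (harmonicSpace l).starProjection (f j)) ∈
      harmonicBasisFunctions Γ l := mem_harmonicBasisFunctions.mpr
    ⟨hf.starProjection l, fun j => Submodule.starProjection_apply_mem _ _⟩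
  exact mem_closure_of_tendsto (hasSum_starProjection isHilbertSum_harmonicSpace (f j))
    (.of_forall fun s => Submodule.sum_mem _ fun l _ => hS l _ (projection_mem l) j)

end BasisFunctions

/-! ### Real orthonormal systems -/

section RealSystems

open scoped InnerProductSpace ComplexStarModule

lemma exists_orthonormal_isSelfAdjoint {E : Type*} [NormedAddCommGroup E] [InnerProductSpace ℂ E]
    [StarAddMonoid E] [StarModule ℂ E] (hE : ∀ x y : E, ⟪star x, star y⟫_ℂ = star ⟪x, y⟫_ℂ)
    (W : Submodule ℂ E) [FiniteDimensional ℂ W] (hW : ∀ x ∈ W, star x ∈ W) :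
    ∃ (n : ℕ) (b : Fin n → E), Orthonormal ℂ b ∧ (∀ i, b i ∈ W) ∧ (∀ i, IsSelfAdjoint (b i)) ∧
      ∀ x ∈ W, ∑ i, ⟪b i, x⟫_ℂ • b i = x := by
  let S : Submodule ℝ E := W.restrictScalars ℝ ⊓ selfAdjoint.submodule ℝ E
  have : FiniteDimensional ℝ (W.restrictScalars ℝ) := inferInstanceAs (FiniteDimensional ℝ W)
  have : FiniteDimensional ℝ S := Submodule.finiteDimensional_of_le inf_le_left
  obtain ⟨n, b, hb, hbS, hsum⟩ := exists_orthonormal_sum_inner_smul S fun x hx y hy => by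
    have hxy := hE x y
    rw [hx.2, hy.2] at hxy
    exact Complex.conj_eq_iff_im.mp hxy.symm
  refine ⟨n, b, hb, fun i => (hbS i).1, fun i => (hbS i).2, fun x hx => ?_⟩
  have re_mem : (ℜ x : E) ∈ W := by
    rw [realPart_apply_coe]
    exact (W.restrictScalars ℝ).smul_mem _ (W.add_mem hx (hW x hx))
  have im_mem : (ℑ x : E) ∈ W := by
    rw [imaginaryPart_apply_coe]
    exact W.smul_mem _ ((W.restrictScalars ℝ).smul_mem _ (W.sub_mem hx (hW x hx)))
  conv_rhs => rw [← realPart_add_I_smul_imaginaryPart x, ← hsum _ ⟨re_mem, (ℜ x).2⟩,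
    ← hsum _ ⟨im_mem, (ℑ x).2⟩, Finset.smul_sum, ← Finset.sum_add_distrib]
  refine Finset.sum_congr rfl fun i _ => ?_
  rw [smul_smul, ← add_smul, ← inner_smul_right, ← inner_add_right,
    realPart_add_I_smul_imaginaryPart]

variable {G : Subgroup (E3 ≃ₗᵢ[ℝ] E3)} {d : ℕ} {Γ : G →* Matrix (Fin d) (Fin d) ℂ}

lemma orthonormal_components (hΓ : ∀ g, Γ g ∈ Matrix.unitaryGroup (Fin d) ℂ)
    (hΓi : (matRep Γ).IsIrreducible) {ζ : Type*} {I : ζ → Fin d → L2S}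
    (hI : ∀ z, IsBasisFunction Γ (I z)) {i : Fin d} (hi : Orthonormal ℂ fun z => I z i) :
    Orthonormal ℂ fun x : ζ × Fin d => I x.1 x.2 := by
  classical
  rw [orthonormal_iff_ite] at hi ⊢
  rintro ⟨z, j⟩ ⟨w, k⟩
  rw [(hI z).inner_apply_apply hΓ hΓi (hI w) i, hi, ← ite_and]
  simp only [Prod.mk.injEq, and_comm]

lemma exists_real_harmonicBasisFunctions (hΓ : ∀ g, Γ g ∈ Matrix.unitaryGroup (Fin d) ℂ)
    (hΓi : (matRep Γ).IsIrreducible) (hΓr : HasRealEntries Γ) (l : ℕ) :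
    ∃ (N : ℕ) (I : Fin N → Fin d → L2S), (∀ n, I n ∈ harmonicBasisFunctions Γ l) ∧
      (∀ n j, IsRealValued (I n j)) ∧ (Orthonormal ℂ fun x : Fin N × Fin d => I x.1 x.2) ∧
      harmonicBasisFunctions Γ l ≤ Submodule.span ℂ (Set.range I) := by
  let i : Fin d := ⟨0, Nat.pos_of_ne_zero (dim_ne_zero_of_isIrreducible hΓi)⟩
  have basis {f} (hf : f ∈ harmonicBasisFunctions Γ l) : IsBasisFunction Γ f :=
    (mem_harmonicBasisFunctions.mp hf).1
  have star_mem {f} (hf : f ∈ harmonicBasisFunctions Γ l) :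
      (fun j => star (f j)) ∈ harmonicBasisFunctions Γ l :=
    mem_harmonicBasisFunctions.mpr ⟨(basis hf).star hΓr, fun j =>
      star_mem_harmonicSpace ((mem_harmonicBasisFunctions.mp hf).2 j)⟩
  let W : Submodule ℂ L2S := (harmonicBasisFunctions Γ l).map (LinearMap.proj i)
  have hW : W ≤ harmonicSpace l :=
    Submodule.map_le_iff_le_comap.mpr fun f hf => (mem_harmonicBasisFunctions.mp hf).2 i
  have : FiniteDimensional ℂ W := Submodule.finiteDimensional_of_le hW
  obtain ⟨N, b, hb, hbW, hbstar, hsum⟩ :=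
    exists_orthonormal_isSelfAdjoint (E := L2S) inner_star_star W (by
      rintro _ ⟨f, hf, rfl⟩
      exact ⟨_, star_mem hf, rfl⟩)
  choose I hI hIb using hbW
  refine ⟨N, I, hI, fun n j => isRealValued_iff.mpr ?_,
    orthonormal_components hΓ hΓi (fun n => basis (hI n)) (by rwa [← funext hIb] at hb),
    fun f hf => ?_⟩
  · refine congrFun ((basis (star_mem (hI n))).eq_of_apply_eq hΓ hΓi (basis (hI n))
      (i := i) ?_) j
    exact (congrArg star (hIb n)).trans ((hbstar n).trans (hIb n).symm)
  · suffices ∑ n, ⟪b n, f i⟫_ℂ • I n = f from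
      this ▸ Submodule.sum_mem _ fun n _ => Submodule.smul_mem _ _ (Submodule.subset_span ⟨n, rfl⟩)
    have hsum_mem := Submodule.sum_mem (harmonicBasisFunctions Γ l) (t := Finset.univ) fun n _ =>
      Submodule.smul_mem _ ⟪b n, f i⟫_ℂ (hI n)
    refine (basis hsum_mem).eq_of_apply_eq hΓ hΓi (basis hf) (i := i) ?_
    refine Eq.trans ?_ (hsum (f i) ⟨f, hf, rfl⟩)
    rw [Finset.sum_apply]
    exact Finset.sum_congr rfl fun n _ => congrArg (⟪b n, f i⟫_ℂ • ·) (hIb n)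

lemma isotypic_eq_topologicalClosure_span {N : ℕ → ℕ} {I : ∀ l, Fin (N l) → Fin d → L2S}
    (hI : ∀ l n, I l n ∈ harmonicBasisFunctions Γ l)
    (hspan : ∀ l, harmonicBasisFunctions Γ l ≤ Submodule.span ℂ (Set.range (I l))) :
    (Submodule.span ℂ {h | ∃ (z : Σ l, Fin (N l)) (j : Fin d),
      h = I z.1 z.2 j}).topologicalClosure = isotypic Γ := by
  refine le_antisymm (Submodule.topologicalClosure_mono (Submodule.span_mono ?_))
    (isotypic_le_topologicalClosure fun l f hf j => ?_)
  · rintro _ ⟨z, j, rfl⟩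
    exact ⟨_, (mem_harmonicBasisFunctions.mp (hI z.1 z.2)).1, j, rfl⟩
  · refine Submodule.span_le.mpr ?_ (Submodule.apply_mem_span_image_of_mem_span
      (LinearMap.proj j : (Fin d → L2S) →ₗ[ℂ] L2S) (hspan l hf))
    rintro _ ⟨_, ⟨n, rfl⟩, rfl⟩
    exact Submodule.subset_span ⟨⟨l, n⟩, j, rfl⟩

lemma exists_real_harmonic_system (hΓ : ∀ g, Γ g ∈ Matrix.unitaryGroup (Fin d) ℂ)
    (hΓi : (matRep Γ).IsIrreducible) :
    ∃ (N : ℕ → ℕ) (I : ∀ l, Fin (N l) → Fin d → L2S),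
      (∀ l n, I l n ∈ harmonicBasisFunctions Γ l) ∧ (∀ l n j, IsRealValued (I l n j)) ∧
      (∀ l, Orthonormal ℂ fun x : Fin (N l) × Fin d => I l x.1 x.2) ∧
      (HasRealEntries Γ → ∀ l,
        harmonicBasisFunctions Γ l ≤ Submodule.span ℂ (Set.range (I l))) := by
  by_cases hΓr : HasRealEntries Γ
  · choose N I hI hreal horth hspan using exists_real_harmonicBasisFunctions hΓ hΓi hΓr
    exact ⟨N, I, hI, hreal, horth, fun _ => hspan⟩
  · exact ⟨fun _ => 0, fun _ n => n.elim0, fun _ n => n.elim0, fun _ n => n.elim0,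
      fun _ => ⟨fun x => x.1.elim0, fun x => x.1.elim0⟩, fun h => absurd h hΓr⟩

lemma orthonormal_harmonic_system {r : ℕ} (A : IrrepList G r) {N : Fin r → ℕ → ℕ}
    {I : ∀ p l, Fin (N p l) → Fin (A.d p) → L2S}
    (hI : ∀ p l n, I p l n ∈ harmonicBasisFunctions (A.Γ p) l)
    (horth : ∀ p l, Orthonormal ℂ fun x : Fin (N p l) × Fin (A.d p) => I p l x.1 x.2) :
    Orthonormal ℂ fun x : Σ p, (Σ l, Fin (N p l)) × Fin (A.d p) =>
      I x.1 x.2.1.1 x.2.1.2 x.2.2 := by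
  have hI' (p l n) := mem_harmonicBasisFunctions.mp (hI p l n)
  refine ⟨fun ⟨p, ⟨l, n⟩, j⟩ => (horth p l).1 (n, j), ?_⟩
  rintro ⟨p, ⟨l, n⟩, j⟩ ⟨q, ⟨m, n'⟩, k⟩ hne
  by_cases hpq : p = q
  · subst hpq
    by_cases hlm : l = m
    · subst hlm
      refine (horth p l).2 (i := (n, j)) (j := (n', k)) fun h => hne ?_
      obtain ⟨rfl, rfl⟩ := Prod.ext_iff.mp h
      rfl
    · exact inner_eq_zero_of_ne hlm ((hI' p l n).2 j) ((hI' p m n').2 k)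
  · exact (hI' p l n).1.inner_eq_zero (A.unitary p) (A.irreducible p) (A.irreducible q)
      (not_nonempty_iff.mp fun h => hpq (A.inequivalent q p h).symm) (hI' q m n').1 j k

lemma exists_isRealOrthonormalBasisSystem {r : ℕ} (A : IrrepList G r) :
    ∃ (N : Fin r → ℕ → ℕ) (I : ∀ p, (Σ l, Fin (N p l)) → Fin (A.d p) → L2S),
      IsRealOrthonormalBasisSystem A I ∧
      (∀ p l n j, IsSphericalHarmonic l (I p ⟨l, n⟩ j)) ∧
      ∀ p, HasRealEntries (A.Γ p) → closedSpanAt I p = isotypic (A.Γ p) := by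
  choose N I hI hreal horth hspan using
    fun p => exists_real_harmonic_system (A.unitary p) (A.irreducible p)
  have hI' (p l n) := mem_harmonicBasisFunctions.mp (hI p l n)
  exact ⟨N, fun p z => I p z.1 z.2, ⟨fun p z => hreal p z.1 z.2, fun p z => (hI' p z.1 z.2).1,
    orthonormal_harmonic_system A hI horth⟩, fun p l n j => mem_harmonicSpace.mp ((hI' p l n).2 j),
    fun p hr => isotypic_eq_topologicalClosure_span (hI p) (hspan p hr)⟩

end RealSystems

/-! ### Completeness of the isotypic subspaces -/

section Subrepresentations

variable {k G V : Type*} [Field k] [Group G] [AddCommGroup V] [Module k V]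
  {ρ : Representation k G V}

lemma finiteDimensional_of_isIrreducible [Finite G] (hρ : ρ.IsIrreducible) :
    FiniteDimensional k V := by
  cases subsingleton_or_nontrivial V with
  | inl _ => infer_instance
  | inr _ =>
    obtain ⟨u, hu⟩ := exists_ne (0 : V)
    have : FiniteDimensional k (⊤ : Submodule k V) :=
      span_orbit_eq_top hρ hu ▸ FiniteDimensional.span_of_finite k (Set.finite_range _)
    exact Submodule.topEquiv.finiteDimensional

lemma isIrreducible_toRepresentation_of_isAtom {σ : Subrepresentation ρ} (hσ : IsAtom σ) :
    σ.toRepresentation.IsIrreducible where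
  exists_pair_ne := ⟨⊥, ⊤, fun h => hσ.1 <| Subrepresentation.toSubmodule_injective <|
    Submodule.subsingleton_iff_eq_bot.mp <| (Submodule.subsingleton_iff k).mp <|
      subsingleton_of_bot_eq_top (congrArg Subrepresentation.toSubmodule h)⟩
  eq_bot_or_eq_top T := by
    let image : Subrepresentation ρ :=
      { toSubmodule := T.toSubmodule.map σ.toSubmodule.subtype
        apply_mem_toSubmodule := by
          rintro g _ ⟨v, hv, rfl⟩
          exact ⟨_, T.apply_mem_toSubmodule g hv, rfl⟩ }
    have image_le : image ≤ σ := by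
      rintro _ ⟨v, -, rfl⟩
      exact v.2
    refine (hσ.le_iff.mp image_le).imp (fun h => ?_) fun h => ?_ <;>
      apply Subrepresentation.toSubmodule_injective <;>
      apply Submodule.map_injective_of_injective (Submodule.injective_subtype σ.toSubmodule)
    · exact (congrArg Subrepresentation.toSubmodule h).trans (Submodule.map_bot _).symm
    · exact (congrArg Subrepresentation.toSubmodule h).trans (Submodule.map_subtype_top _).symm

end Subrepresentations

lemma IrrepList.exists_equiv {G : Type*} [Group G] {r : ℕ} (A : IrrepList G r) {V : Type*}
    [AddCommGroup V] [Module ℂ V] [FiniteDimensional ℂ V] {ρ : Representation ℂ G V}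
    (hρ : ρ.IsIrreducible) : ∃ p, Nonempty ((matRep (A.Γ p)).Equiv ρ) := by
  obtain ⟨f⟩ := nonempty_equiv_matrixRepOfBasis (Module.finBasis ℂ V) ρ
  obtain ⟨p, ⟨e⟩⟩ := A.exhaustive _ _ (isIrreducible_of_equiv f hρ)
  exact ⟨p, ⟨e.trans f⟩⟩

section Completeness

variable {G : Subgroup (E3 ≃ₗᵢ[ℝ] E3)}

/-- The representation of a group of isometries on the functions on the sphere, by
`(g • f) x = f (g⁻¹ x)`. -/
noncomputable def translateRep (G : Subgroup (E3 ≃ₗᵢ[ℝ] E3)) : Representation ℂ G L2S where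
  toFun g := (translate (g : E3 ≃ₗᵢ[ℝ] E3)).toLinearMap
  map_one' := by rw [Subgroup.coe_one, map_one]; rfl
  map_mul' g h := by rw [Subgroup.coe_mul, map_mul]; rfl

variable {d : ℕ} {Γ : G →* Matrix (Fin d) (Fin d) ℂ}

lemma isBasisFunction_of_intertwiningMap
    (φ : (matRep Γ).IntertwiningMap (translateRep G)) :
    IsBasisFunction Γ fun j => φ (Pi.single j 1) := by
  refine isBasisFunction_iff.mpr fun g j => ?_
  calc translateRep G g (φ (Pi.single j 1))
      = φ (matRep Γ g (Pi.single j 1)) := (φ.isIntertwining _ _ g _).symm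
    _ = φ (∑ k, Γ g k j • Pi.single k 1) := by
      rw [matRep_apply, Matrix.mulVec_single_one, pi_eq_sum_univ' ((Γ g).col j)]
      rfl
    _ = ∑ k, Γ g k j • φ (Pi.single k 1) := by simp only [map_sum, map_smul]

lemma intertwiningMap_apply_mem_isotypic
    (φ : (matRep Γ).IntertwiningMap (translateRep G)) (v : Fin d → ℂ) : φ v ∈ isotypic Γ := by
  rw [pi_eq_sum_univ' v, map_sum]
  refine Submodule.sum_mem _ fun j _ => ?_
  rw [map_smul]
  exact Submodule.smul_mem _ _ <| Submodule.le_topologicalClosure _ <| Submodule.subset_span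
    ⟨_, isBasisFunction_of_intertwiningMap φ, j, rfl⟩

lemma le_iSup_isotypic_of_isAtom [Finite G] {r : ℕ} (A : IrrepList G r)
    {σ : Subrepresentation (translateRep G)} (hσ : IsAtom σ) :
    σ.toSubmodule ≤ ⨆ p, isotypic (A.Γ p) := by
  have irreducible := isIrreducible_toRepresentation_of_isAtom hσ
  have := finiteDimensional_of_isIrreducible irreducible
  obtain ⟨p, ⟨e⟩⟩ := A.exists_equiv irreducible
  let inclusion : (matRep (A.Γ p)).IntertwiningMap (translateRep G) :=
    { toLinearMap := σ.toSubmodule.subtype ∘ₗ e.toIntertwiningMap.toLinearMap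
      isIntertwining' := fun g => LinearMap.ext fun v =>
        congrArg Subtype.val (e.toIntertwiningMap.isIntertwining _ _ g v) }
  intro f hf
  refine Submodule.mem_iSup_of_mem p ?_
  obtain ⟨v, hv⟩ := e.toLinearEquiv.surjective ⟨f, hf⟩
  have inclusion_apply : inclusion v = f := congrArg Subtype.val hv
  exact inclusion_apply ▸ intertwiningMap_apply_mem_isotypic inclusion v

theorem iSup_isotypic [Finite G] {r : ℕ} (A : IrrepList G r) : ⨆ p, isotypic (A.Γ p) = ⊤ := by
  refine Submodule.eq_top_iff'.mpr fun f => ?_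
  have f_mem := Submodule.mem_top (R := MonoidAlgebra ℂ G) (M := (translateRep G).asModule) (x := f)
  rw [← IsSemisimpleModule.sSup_simples_eq_top (MonoidAlgebra ℂ G) (translateRep G).asModule,
    sSup_eq_iSup'] at f_mem
  refine Submodule.iSup_induction (M := (translateRep G).asModule) _
    (motive := fun h : L2S => h ∈ ⨆ p, isotypic (A.Γ p)) f_mem
    (fun m h hh => ?_) (Submodule.zero_mem _) fun _ _ => Submodule.add_mem _
  refine le_iSup_isotypic_of_isAtom A (σ := Subrepresentation.ofSubmodule' m.1) ?_ hh
  exact (OrderIso.isAtom_iff Subrepresentation.subrepresentationSubmoduleOrderIso _).mp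
    (isSimpleModule_iff_isAtom.mp m.2)

end Completeness

/-! ### Rotation groups as matrix groups -/

section RotationMatrices

open Matrix
open scoped Pointwise

variable {K n ι : Type*} [CommRing K] [Fintype n]

/-- The matrix with columns `v (s a)`, multiplied by `R`. If `R` is the inverse of the matrix with
columns `v (p a)`, this is the matrix which maps `v (p a)` to `v (s a)`. -/
def frameMatrix (v : ι → n → K) (R : Matrix n n K) (s : n → ι) : Matrix n n K :=
  (of (v ∘ s))ᵀ * R

lemma mul_frameMatrix {v : ι → n → K} {A : Matrix n n K} {π : ι → ι}
    (hA : ∀ i, A *ᵥ v i = v (π i)) (R : Matrix n n K) (p : n → ι) :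
    A * frameMatrix v R p = frameMatrix v R (π ∘ p) := by
  rw [frameMatrix, ← Matrix.mul_assoc, frameMatrix]
  congr 1
  ext a b
  exact congrFun (hA (p b)) a

lemma map_frameMatrix {L : Type*} [CommRing L] (φ : K →+* L) (v : ι → n → K) (R : Matrix n n K)
    (s : n → ι) :
    (frameMatrix v R s).map φ = frameMatrix (fun i => φ ∘ v i) (R.map φ) s := by
  rw [frameMatrix, Matrix.map_mul]
  rfl

variable [DecidableEq n]

/-- The rotation matrices with entries in `K` which permute the points `v i`. If equality in `K` is
decidable, statements about this group can be checked by evaluation. -/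
def rotationMatrices (v : ι → n → K) : Subgroup (SpecialLinearGroup n K) where
  carrier := {N | N.transpose = N⁻¹ ∧ N ∈ MulAction.stabilizer _ (Set.range v)}
  one_mem' := ⟨Subtype.ext (by simp), one_mem _⟩
  mul_mem' := by
    rintro M N ⟨hM, hMv⟩ ⟨hN, hNv⟩
    refine ⟨?_, mul_mem hMv hNv⟩
    rw [_root_.mul_inv_rev, ← hM, ← hN]
    exact Subtype.ext (transpose_mul _ _)
  inv_mem' := by
    rintro N ⟨hN, hNv⟩
    refine ⟨?_, inv_mem hNv⟩
    rw [inv_inv, ← hN]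
    exact Subtype.ext (transpose_transpose _)

lemma transpose_mul_self_of_mem_rotationMatrices {v : ι → n → K} {N : SpecialLinearGroup n K}
    (hN : N ∈ rotationMatrices v) : (N : Matrix n n K)ᵀ * N = 1 :=
  Subtype.ext_iff.mp (eq_inv_iff_mul_eq_one.mp hN.1 : N.transpose * N = 1)

lemma mem_rotationMatrices [Finite ι] {v : ι → n → K} {N : SpecialLinearGroup n K} :
    N ∈ rotationMatrices v ↔ (N : Matrix n n K)ᵀ * N = 1 ∧ ∀ i, ∃ j, v j = N *ᵥ v i :=
  and_congr (eq_inv_iff_mul_eq_one.trans Subtype.ext_iff)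
    ((MulAction.mem_stabilizer_set' (Set.finite_range v)).trans Set.forall_mem_range)

lemma dotProduct_mulVec_mulVec {A : Matrix n n K} (hA : Aᵀ * A = 1) (x y : n → K) :
    A *ᵥ x ⬝ᵥ A *ᵥ y = x ⬝ᵥ y := by
  rw [dotProduct_mulVec, vecMul_mulVec, hA, vecMul_one]

lemma triple_product_mulVec {A : Matrix (Fin 3) (Fin 3) K} (hA : A.det = 1) (x y z : Fin 3 → K) :
    (A *ᵥ x) ⬝ᵥ ((A *ᵥ y) ⨯₃ (A *ᵥ z)) = x ⬝ᵥ (y ⨯₃ z) := by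
  have rows : ![A *ᵥ x, A *ᵥ y, A *ᵥ z] = of ![x, y, z] * Aᵀ := by
    ext a b
    fin_cases a <;> exact dotProduct_comm (A b) _
  rw [triple_product_eq_det, triple_product_eq_det, rows]
  exact (det_mul _ _).trans (by rw [det_transpose, hA, mul_one]; rfl)

lemma exists_eq_frameMatrix [Finite ι] {v : ι → n → K} {R : Matrix n n K} {p : n → ι}
    (hR : frameMatrix v R p = 1) {N : SpecialLinearGroup n K} (hN : N ∈ rotationMatrices v) :
    ∃ s : n → ι, (∀ a, v (s a) = N *ᵥ v (p a)) ∧ N = frameMatrix v R s := by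
  choose π hπ using (mem_rotationMatrices.mp hN).2
  refine ⟨π ∘ p, fun a => hπ (p a), ?_⟩
  rw [← mul_frameMatrix fun i => (hπ i).symm, hR, Matrix.mul_one]

lemma finite_rotationMatrices [Finite ι] {v : ι → n → K} {R : Matrix n n K} {p : n → ι}
    (hR : frameMatrix v R p = 1) : Finite (rotationMatrices v) := by
  choose s _ hs using fun N : rotationMatrices v => exists_eq_frameMatrix hR N.2
  exact .of_injective s fun M N hMN => Subtype.ext (Subtype.ext (by rw [hs M, hs N, hMN]))

lemma forall_mem_rotationMatrices [Finite ι] {v : ι → Fin 3 → K} {R : Matrix (Fin 3) (Fin 3) K}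
    {p q r : ι} (hR : frameMatrix v R ![p, q, r] = 1) {P : Matrix (Fin 3) (Fin 3) K → Prop}
    (h : ∀ i j, v i ⬝ᵥ v j = v p ⬝ᵥ v q → ∀ k, v i ⬝ᵥ v k = v p ⬝ᵥ v r →
      v j ⬝ᵥ v k = v q ⬝ᵥ v r → v i ⬝ᵥ (v j ⨯₃ v k) = v p ⬝ᵥ (v q ⨯₃ v r) →
      P (frameMatrix v R ![i, j, k])) :
    ∀ N ∈ rotationMatrices v, P N := by
  intro N hN
  obtain ⟨s, hs, hNs⟩ := exists_eq_frameMatrix hR hN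
  have gram (a b : Fin 3) : v (s a) ⬝ᵥ v (s b) = v (![p, q, r] a) ⬝ᵥ v (![p, q, r] b) := by
    rw [hs, hs, dotProduct_mulVec_mulVec (transpose_mul_self_of_mem_rotationMatrices hN)]
  have orientation : v (s 0) ⬝ᵥ (v (s 1) ⨯₃ v (s 2)) = v p ⬝ᵥ (v q ⨯₃ v r) := by
    rw [hs, hs, hs, triple_product_mulVec N.2]
    rfl
  have hs' : ![s 0, s 1, s 2] = s := by
    ext a
    fin_cases a <;> rfl
  have hP := h _ _ (gram 0 1) _ (gram 0 2) (gram 1 2) orientation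
  rwa [hs', ← hNs] at hP

lemma mul_self_eq_one_of_transpose_eq {v : ι → n → K} {N : rotationMatrices v}
    (h : (N : Matrix n n K)ᵀ = N) : N * N = 1 :=
  Subtype.ext <| Subtype.ext <|
    (congrArg (· * (N : Matrix n n K)) h.symm).trans
      (transpose_mul_self_of_mem_rotationMatrices N.2)

section Real

variable (φ : K →+* ℝ)

/-- The points of the Euclidean space with the coordinates `φ (v i a)`. -/
def vertexSet (v : ι → n → K) : Set (EuclideanSpace ℝ n) :=
  (fun x => WithLp.toLp 2 (φ ∘ x)) '' Set.range v

lemma map_mem_orthogonalGroup {N : Matrix n n K} (hN : Nᵀ * N = 1) :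
    N.map φ ∈ orthogonalGroup n ℝ := by
  rw [mem_orthogonalGroup_iff']
  change (N.map φ)ᵀ * N.map φ = 1
  rw [← transpose_map, ← Matrix.map_mul, hN, Matrix.map_one φ φ.map_zero φ.map_one]

/-- The linear isometries given by the matrices in `rotationMatrices v`. -/
noncomputable def rotationIsometry (v : ι → n → K) :
    rotationMatrices v →* (EuclideanSpace ℝ n ≃ₗᵢ[ℝ] EuclideanSpace ℝ n) :=
  orthogonalMatrix.symm.toMonoidHom.comp
    { toFun N := ⟨(N : Matrix n n K).map φ,
        map_mem_orthogonalGroup φ (transpose_mul_self_of_mem_rotationMatrices N.2)⟩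
      map_one' := Subtype.ext (Matrix.map_one φ φ.map_zero φ.map_one)
      map_mul' _ _ := Subtype.ext Matrix.map_mul }

variable {φ}

lemma orthogonalMatrix_rotationIsometry {v : ι → n → K} (N : rotationMatrices v) :
    (orthogonalMatrix (rotationIsometry φ v N) : Matrix n n ℝ) = (N : Matrix n n K).map φ :=
  congrArg Subtype.val (orthogonalMatrix.apply_symm_apply _)

lemma rotationIsometry_toLp {v : ι → n → K} (N : rotationMatrices v) (x : n → K) :
    rotationIsometry φ v N (WithLp.toLp 2 (φ ∘ x)) =
      WithLp.toLp 2 (φ ∘ ((N : SpecialLinearGroup n K) • x)) := by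
  refine PiLp.ext fun a => ?_
  rw [apply_eq_sum, orthogonalMatrix_rotationIsometry]
  exact (RingHom.map_mulVec φ _ x a).symm

lemma rotationIsometry_injective (hφ : Function.Injective φ) (v : ι → n → K) :
    Function.Injective (rotationIsometry φ v) := fun M N hMN =>
  Subtype.ext <| Subtype.ext <| Matrix.map_injective hφ <|
    (orthogonalMatrix_rotationIsometry M).symm.trans <| by
      rw [hMN, orthogonalMatrix_rotationIsometry]

lemma image_vertexSet {v : ι → n → K} (N : rotationMatrices v) :
    rotationIsometry φ v N '' vertexSet φ v = vertexSet φ v := by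
  rw [vertexSet, Set.image_image]
  simp only [rotationIsometry_toLp]
  refine (Set.image_image (fun x => WithLp.toLp 2 (φ ∘ x)) _ _).symm.trans ?_
  exact congrArg _ N.2.2

lemma exists_map_eq_of_mulVec_eq [Finite ι] (hφ : Function.Injective φ) {v : ι → n → K}
    {R : Matrix n n K} {p : n → ι} (hR : frameMatrix v R p = 1) {A : Matrix n n ℝ}
    (hA : Aᵀ * A = 1) (hdet : A.det = 1) (hv : ∀ i, ∃ j, φ ∘ v j = A *ᵥ (φ ∘ v i)) :
    ∃ N : rotationMatrices v, (N : Matrix n n K).map φ = A := by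
  choose π hπ using hv
  let N := frameMatrix v R (π ∘ p)
  have map_N : N.map φ = A := by
    rw [map_frameMatrix, ← mul_frameMatrix fun i => (hπ i).symm, ← map_frameMatrix, hR,
      Matrix.map_one φ φ.map_zero φ.map_one, Matrix.mul_one]
  have orthogonal : Nᵀ * N = 1 := by
    apply Matrix.map_injective hφ
    beta_reduce
    rw [Matrix.map_mul, transpose_map, map_N, hA, Matrix.map_one φ φ.map_zero φ.map_one]
  have det_N : N.det = 1 := hφ <| by
    rw [RingHom.map_det, RingHom.mapMatrix_apply, map_N, hdet, map_one]
  have permutes (i : ι) : v (π i) = N *ᵥ v i := by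
    apply hφ.comp_left
    beta_reduce
    rw [hπ, ← map_N]
    exact (funext (RingHom.map_mulVec φ N (v i))).symm
  exact ⟨⟨⟨N, det_N⟩, mem_rotationMatrices.mpr ⟨orthogonal, fun i => ⟨_, permutes i⟩⟩⟩, map_N⟩

lemma range_rotationIsometry [Finite ι] (hφ : Function.Injective φ) {v : ι → Fin 3 → K}
    {R : Matrix (Fin 3) (Fin 3) K} {p : Fin 3 → ι} (hR : frameMatrix v R p = 1) :
    (rotationIsometry φ v).range = rotationGroup (vertexSet φ v) := by
  ext g
  constructor
  · rintro ⟨N, rfl⟩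
    refine ⟨?_, image_vertexSet N⟩
    rw [← det_orthogonalMatrix, orthogonalMatrix_rotationIsometry]
    exact (RingHom.map_det φ _).symm.trans ((congrArg φ N.1.2).trans φ.map_one)
  · rintro ⟨hdet, hg⟩
    have permutes (i : ι) : ∃ j, φ ∘ v j = orthogonalMatrix g *ᵥ (φ ∘ v i) := by
      obtain ⟨_, ⟨j, rfl⟩, hj⟩ := hg.subset (Set.mem_image_of_mem g ⟨_, ⟨i, rfl⟩, rfl⟩)
      exact ⟨j, (congrArg WithLp.ofLp hj).trans (orthogonalMatrix_mulVec g _).symm⟩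
    obtain ⟨N, hN⟩ := exists_map_eq_of_mulVec_eq hφ hR
      ((mem_orthogonalGroup_iff' _ _).mp (orthogonalMatrix g).2)
      ((det_orthogonalMatrix g).trans hdet) permutes
    exact ⟨N, orthogonalMatrix.injective
      (Subtype.ext ((orthogonalMatrix_rotationIsometry N).trans hN))⟩

/-- The rotation group of the vertex set is isomorphic to the group of its matrices. -/
noncomputable def rotationGroupEquiv [Finite ι] (hφ : Function.Injective φ) {v : ι → Fin 3 → K}
    {R : Matrix (Fin 3) (Fin 3) K} {p : Fin 3 → ι} (hR : frameMatrix v R p = 1) :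
    rotationGroup (vertexSet φ v) ≃* rotationMatrices v :=
  ((MonoidHom.ofInjective (rotationIsometry_injective hφ v)).trans
    (MulEquiv.subgroupCongr (range_rotationIsometry hφ hR))).symm

end Real

end RotationMatrices

lemma map_conj_rotationGroup (Q : E3 ≃ₗᵢ[ℝ] E3) (V : Set E3) :
    (rotationGroup V).map (MulAut.conj Q).toMonoidHom = rotationGroup (Q '' V) := by
  ext g
  rw [Subgroup.mem_map_equiv]
  refine and_congr (Eq.congr_left ?_) ?_
  · exact LinearMap.det_conj _ Q.toLinearEquiv.symm
  · have image_conj : (MulAut.conj Q).symm g '' V = Q.symm '' (g '' (Q '' V)) := by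
      rw [Set.image_image, Set.image_image]
      rfl
    rw [image_conj]
    exact (Q.toEquiv.eq_image_iff_symm_image_eq _ _).symm

/-! ### Transport along isomorphisms -/

section Transport

variable {G H : Type*} [Group G] [Group H]

lemma isIrreducible_comp {k V : Type*} [Field k] [AddCommGroup V] [Module k V]
    {ρ : Representation k H V} (hρ : ρ.IsIrreducible) (e : G ≃* H) :
    Representation.IsIrreducible (ρ.comp e.toMonoidHom) := by
  let f : Subrepresentation (ρ.comp e.toMonoidHom) ≃o Subrepresentation ρ :=
    { toFun W := ⟨W.toSubmodule, fun h v hv => by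
        have apply_mem := W.apply_mem_toSubmodule (e.symm h) hv
        rwa [MonoidHom.comp_apply, MulEquiv.coe_toMonoidHom, e.apply_symm_apply] at apply_mem⟩
      invFun W := ⟨W.toSubmodule, fun g _ hv => W.apply_mem_toSubmodule (e g) hv⟩
      map_rel_iff' := Iff.rfl }
  exact f.isSimpleOrder_iff.mpr hρ

/-- The list of the irreducible representations of `G` obtained from the one of an isomorphic
group. -/
def IrrepList.comap (e : G ≃* H) {r : ℕ} (A : IrrepList H r) : IrrepList G r where
  d := A.d
  Γ p := (A.Γ p).comp e.toMonoidHom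
  unitary p g := A.unitary p (e g)
  irreducible p := isIrreducible_comp (A.irreducible p) e
  inequivalent p q := fun ⟨f⟩ => A.inequivalent p q ⟨.mk f.toLinearEquiv fun h => by
    obtain ⟨g, rfl⟩ := e.surjective h
    exact f.isIntertwining' g⟩
  exhaustive n Δ hΔ := by
    obtain ⟨p, ⟨f⟩⟩ := A.exhaustive n (Δ.comp e.symm.toMonoidHom) (isIrreducible_comp hΔ e.symm)
    exact ⟨p, ⟨.mk f.toLinearEquiv fun g => (f.isIntertwining' (e g)).trans
      (congrArg (fun g => matRep Δ g ∘ₗ _) (e.symm_apply_apply g))⟩⟩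

end Transport

/-! ### Occurrence of all representations -/

section Occurrence

lemma exists_injOn_apply {k V W : Type*} [Field k] [Infinite k] [AddCommGroup V] [Module k V]
    [AddCommGroup W] [Module k W] {s : Set (V →ₗ[k] W)} (hs : s.Finite) :
    ∃ v, s.InjOn fun f => f v := by
  by_contra! not_injOn
  have := hs.to_subtype
  have cover : ⋃ p : {p : s × s // p.1 ≠ p.2},
      (LinearMap.eqLocus (p.1.1 : V →ₗ[k] W) p.1.2 : Set V) = Set.univ := by
    refine Set.iUnion_eq_univ_iff.mpr fun v => ?_
    have h := not_injOn v
    simp only [Set.InjOn, not_forall] at h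
    obtain ⟨f, hf, g, hg, hfg, hne⟩ := h
    exact ⟨⟨(⟨f, hf⟩, ⟨g, hg⟩), fun h => hne (congrArg Subtype.val h)⟩, hfg⟩
  obtain ⟨p, hp⟩ := Subspace.exists_eq_top_of_iUnion_eq_univ cover
  exact p.2 (Subtype.ext (LinearMap.eqLocus_eq_top.mp hp))

lemma exists_injOn_actS {s : Set (E3 ≃ₗᵢ[ℝ] E3)} (hs : s.Finite) :
    ∃ x, s.InjOn fun g => actS g x := by
  let linear (g : E3 ≃ₗᵢ[ℝ] E3) : E3 →ₗ[ℝ] E3 := g.toLinearEquiv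
  obtain ⟨v, hv⟩ := exists_injOn_apply (((hs.image linear).insert 1).insert 0)
  have v_ne : v ≠ 0 := fun h => zero_ne_one (hv (.inl rfl) (.inr (.inl rfl)) h.symm)
  refine ⟨⟨‖v‖⁻¹ • v, by simp [norm_smul, v_ne]⟩, fun g hg h hh hgh => ?_⟩
  have smul_eq : ‖v‖⁻¹ • g v = ‖v‖⁻¹ • h v := by
    simpa only [actS, map_smul] using congrArg Subtype.val hgh
  have linear_eq : linear g = linear h := hv (.inr (.inr ⟨g, hg, rfl⟩)) (.inr (.inr ⟨h, hh, rfl⟩))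
    (smul_right_injective E3 (inv_ne_zero (norm_ne_zero_iff.mpr v_ne)) smul_eq)
  exact LinearIsometryEquiv.ext (LinearMap.congr_fun linear_eq)

lemma linearIndependent_polyC_apply :
    LinearIndependent ℂ fun (x : S2) (P : MvPolynomial (Fin 3) ℂ) => polyC P x := by
  refine (linearIndependent_monoidHom (MvPolynomial (Fin 3) ℂ) ℂ).comp
    (fun x : S2 => ((ContinuousMap.evalAlgHom ℂ ℂ x).comp polyC : MvPolynomial (Fin 3) ℂ →* ℂ))
    fun x y hxy => Subtype.ext (PiLp.ext fun i => Complex.ofReal_injective ?_)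
  simpa [polyC_apply] using DFunLike.congr_fun hxy (MvPolynomial.X i)

lemma linearIndependent_translate :
    LinearIndependent ℂ fun g : E3 ≃ₗᵢ[ℝ] E3 => (translate g).toLinearMap := by
  refine linearIndependent_iff_finset_linearIndependent.mpr fun s =>
    Fintype.linearIndependent_iff.mpr fun c hc => ?_
  obtain ⟨x, hx⟩ := exists_injOn_actS (s.finite_toSet.image (·⁻¹))
  have inj : Function.Injective fun g : s => actS (g : E3 ≃ₗᵢ[ℝ] E3)⁻¹ x := fun g h hgh =>
    Subtype.ext (inv_injective (hx ⟨g, g.2, rfl⟩ ⟨h, h.2, rfl⟩ hgh))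
  refine Fintype.linearIndependent_iff.mp (linearIndependent_polyC_apply.comp _ inj) c
    (funext fun P => ?_)
  have polyL2_eq : polyL2 (∑ g, c g • substMatrix
      (orthogonalMatrix (g : E3 ≃ₗᵢ[ℝ] E3)⁻¹ : Matrix (Fin 3) (Fin 3) ℝ) P) = 0 := by
    simpa [translate_polyL2] using LinearMap.congr_fun hc (polyL2 P)
  simpa [-map_inv, polyC_substMatrix] using DFunLike.congr_fun (polyL2_eq_zero_iff.mp polyL2_eq) x

variable {G : Subgroup (E3 ≃ₗᵢ[ℝ] E3)} [Finite G]

lemma exists_isBasisFunction_ne_zero {d : ℕ} (Γ : G →* Matrix (Fin d) (Fin d) ℂ) (i : Fin d) :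
    ∃ f, IsBasisFunction Γ f ∧ f i ≠ 0 := by
  have := Fintype.ofFinite G
  have sum_ne : ∑ h : G, Γ h⁻¹ i i • (translate (h : E3 ≃ₗᵢ[ℝ] E3)).toLinearMap ≠ 0 := fun h => by
    have := Fintype.linearIndependent_iff.mp
      (linearIndependent_translate.comp _ Subtype.val_injective) _ h 1
    simp at this
  obtain ⟨u, hu⟩ := DFunLike.ne_iff.mp sum_ne
  refine ⟨fun j => ∑ h : G, Γ h⁻¹ i j • translate (h : E3 ≃ₗᵢ[ℝ] E3) u,
    isBasisFunction_iff.mpr fun g j => ?_, by simpa using hu⟩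
  calc translate (g : E3 ≃ₗᵢ[ℝ] E3) (∑ h : G, Γ h⁻¹ i j • translate (h : E3 ≃ₗᵢ[ℝ] E3) u)
      = ∑ h : G, Γ ((g * h)⁻¹ * g) i j • translate ((g * h : G) : E3 ≃ₗᵢ[ℝ] E3) u := by
        simp [map_sum]
    _ = ∑ h : G, Γ (h⁻¹ * g) i j • translate (h : E3 ≃ₗᵢ[ℝ] E3) u :=
        Equiv.sum_comp (Equiv.mulLeft g) fun h =>
          Γ (h⁻¹ * g) i j • translate (h : E3 ≃ₗᵢ[ℝ] E3) u
    _ = ∑ k, Γ g k j • ∑ h : G, Γ h⁻¹ i k • translate (h : E3 ≃ₗᵢ[ℝ] E3) u := by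
        simp only [map_mul, Matrix.mul_apply, Finset.sum_smul, Finset.smul_sum, smul_smul]
        rw [Finset.sum_comm]
        simp only [mul_comm]

lemma nonempty_of_closedSpan_eq_top {r : ℕ} {A : IrrepList G r} {ζ : Fin r → Type*}
    {I : ∀ p, ζ p → Fin (A.d p) → L2S} (hI : IsRealOrthonormalBasisSystem A I)
    (h : closedSpan I = ⊤) (p : Fin r) : Nonempty (ζ p) := by
  by_contra hp
  rw [not_nonempty_iff] at hp
  let i : Fin (A.d p) := ⟨0, Nat.pos_of_ne_zero (dim_ne_zero_of_isIrreducible (A.irreducible p))⟩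
  obtain ⟨f, hf, hfi⟩ := exists_isBasisFunction_ne_zero (A.Γ p) i
  have orthogonal : closedSpan I ≤ (ℂ ∙ f i)ᗮ := by
    refine Submodule.topologicalClosure_minimal _ (Submodule.span_le.mpr ?_)
      (Submodule.isClosed_orthogonal _)
    rintro _ ⟨q, z, j, rfl⟩
    have inequivalent : IsEmpty ((matRep (A.Γ p)).Equiv (matRep (A.Γ q))) :=
      not_nonempty_iff.mp fun e => hp.false (A.inequivalent _ _ e ▸ z)
    exact Submodule.mem_orthogonal_singleton_iff_inner_left.mpr
      ((hI.transforms q z).inner_eq_zero (A.unitary q) (A.irreducible q) (A.irreducible p)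
        inequivalent hf j i)
  rw [h, top_le_iff, Submodule.orthogonal_eq_top_iff, Submodule.span_singleton_eq_bot]
    at orthogonal
  exact hfi orthogonal

end Occurrence

/-! ### Vectors fixed up to sign by dihedral groups -/

section Dihedral

lemma eq_one_of_one_add_add_mul_self_eq_zero {k R : Type*} [Field k] [CharZero k] [Ring R]
    [Algebra k R] {c : R} {t : Fin 3 → R} (ht : ∀ i, t i * t i = 1)
    (htt : ∀ i, t i * t (i + 1) = t (i + 2)) (hct : ∀ i, c * t i = t (i + 1) * c)
    (hc : 1 + c + c * c = 0) : t 0 = 1 := by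
  have mul_add_two (i : Fin 3) : t i * t (i + 2) = t (i + 1) := by
    rw [← htt, ← mul_assoc, ht, one_mul]
  have conj (i : Fin 3) : 1 + t (i + 2) * c + t (i + 1) * (c * c) = 0 := by
    have two_eq : (1 : Fin 3) + 1 = 2 := rfl
    have hti : t i * (1 + c + c * c) * t i = 0 := by rw [hc, mul_zero, zero_mul]
    rwa [mul_add, mul_add, add_mul, add_mul, mul_one, ht, mul_assoc, hct, ← mul_assoc, htt,
      mul_assoc, mul_assoc c, hct, ← mul_assoc c, hct, ← mul_assoc, ← mul_assoc, add_assoc i,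
      two_eq, mul_add_two, mul_assoc] at hti
  have sum_eq : t 0 + t 1 + t 2 = 1 + 1 + 1 := by
    have sum_conj : 1 + 1 + 1 - (t 0 + t 1 + t 2) = 1 + t 2 * c + t 1 * (c * c) +
        (1 + t 0 * c + t 2 * (c * c)) + (1 + t 1 * c + t 0 * (c * c)) -
        (t 0 + t 1 + t 2) * (1 + c + c * c) := by
      noncomm_ring
    refine (sub_eq_zero.mp (sum_conj.trans ?_)).symm
    rw [hc, mul_zero, sub_zero]
    exact (congrArg₂ _ (congrArg₂ _ (conj 0) (conj 1)) (conj 2)).trans (by simp)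
  have four_smul : (4 : k) • t 0 = (4 : k) • 1 := by
    have mul_sum : t 0 * (1 + 1 + 1) = 1 + t 2 + t 1 := by
      rw [← sum_eq, mul_add, mul_add, ht]
      exact congrArg₂ _ (congrArg _ (htt 0)) (mul_add_two 0)
    calc (4 : k) • t 0 = t 0 * (1 + 1 + 1) + t 0 := by rw [ofNat_smul_eq_nsmul]; noncomm_ring
      _ = 1 + (t 0 + t 1 + t 2) := by rw [mul_sum]; abel
      _ = (4 : k) • 1 := by rw [sum_eq, ofNat_smul_eq_nsmul]; abel
  exact smul_right_injective R (r := (4 : k)) (by norm_num) four_smul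

variable {G V : Type*} [Group G] [AddCommGroup V] [Module ℂ V]

lemma exists_mem_signStabilizer (ρ : Representation ℂ G V) {u : V} (hu : u ≠ 0) {s : G}
    (hs : s * s = 1) :
    ∃ w ≠ 0, s ∈ signStabilizer ρ w ∧ ∀ (g : G) (ε : ℂ), ρ g u = ε • u →
      ρ (s * g * s) u = ε • u → ρ g w = ε • w := by
  by_cases h : u + ρ s u = 0
  · exact ⟨u, hu, .inr (neg_eq_of_add_eq_zero_right h).symm, fun _ _ hg _ => hg⟩
  · refine ⟨u + ρ s u, h, .inl ?_, fun g ε hg hgs => ?_⟩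
    · rw [map_add, ← Module.End.mul_apply, ← map_mul, hs, map_one, Module.End.one_apply, add_comm]
    · have commute : g * s = s * (s * g * s) := by
        rw [mul_assoc s g s, ← mul_assoc s s, hs, one_mul]
      rw [map_add, hg, ← Module.End.mul_apply, ← map_mul, commute, map_mul, Module.End.mul_apply,
        hgs, map_smul, smul_add]

lemma exists_mem_signStabilizer_of_commute [Nontrivial V] (ρ : Representation ℂ G V) {a b : G}
    (ha : a * a = 1) (hb : b * b = 1) (hab : Commute a b) :
    ∃ u ≠ 0, a ∈ signStabilizer ρ u ∧ b ∈ signStabilizer ρ u := by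
  obtain ⟨v, hv⟩ := exists_ne (0 : V)
  obtain ⟨u, hu, hau, -⟩ := exists_mem_signStabilizer ρ hv ha
  obtain ⟨w, hw, hbw, eigen⟩ := exists_mem_signStabilizer ρ hu hb
  have conj : b * a * b = a := by rw [← hab, mul_assoc, hb, mul_one]
  refine ⟨w, hw, hau.imp (fun h => ?_) fun h => ?_, hbw⟩
  · simpa [h, conj] using eigen a 1
  · simpa [h, conj] using eigen a (-1)

lemma exists_apply_eq_self [Nontrivial V] (ρ : Representation ℂ G V) {c s k : G} {t : Fin 3 → G}
    (hc : c ^ 3 = 1) (hcs : s * c * s = c * c) (ht : ∀ i, t i * t i = 1)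
    (htt : ∀ i, t i * t (i + 1) = t (i + 2)) (hct : ∀ i, c * t i = t (i + 1) * c)
    (hk : k * t 0 = s * k) : ∃ w ≠ 0, ρ c w = w := by
  by_contra! h
  have sum_eq_zero : 1 + ρ c + ρ c * ρ c = 0 := by
    refine LinearMap.ext fun v => by_contra fun hv => h _ hv ?_
    have hρc : ρ c * (ρ c * ρ c) = 1 := by rw [← map_mul, ← map_mul, ← pow_three, hc, map_one]
    rw [← Module.End.mul_apply, mul_add, mul_add, hρc, mul_one]
    congr 1
    abel
  have apply_t : ρ (t 0) = 1 :=
    eq_one_of_one_add_add_mul_self_eq_zero (k := ℂ) (t := fun i => ρ (t i))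
      (fun i => by rw [← map_mul, ht, map_one]) (fun i => by rw [← map_mul, htt])
      (fun i => by rw [← map_mul, hct, map_mul]) sum_eq_zero
  have apply_s : ρ s = 1 := by
    rw [eq_mul_inv_of_mul_eq hk.symm, map_mul, map_mul, apply_t, mul_one, ← map_mul,
      mul_inv_cancel, map_one]
  obtain ⟨v, hv⟩ := exists_ne (0 : V)
  have apply_ne_zero : ρ c v ≠ 0 := fun hcv =>
    hv (by rw [← ρ.inv_self_apply c v, hcv, map_zero])
  refine h _ apply_ne_zero ?_
  rw [← Module.End.mul_apply, ← map_mul, ← hcs, map_mul, map_mul, apply_s, one_mul, mul_one]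

lemma exists_mem_signStabilizer_of_dihedral [Nontrivial V] (ρ : Representation ℂ G V)
    {c s k : G} {t : Fin 3 → G} (hc : c ^ 3 = 1) (hs : s * s = 1) (hcs : s * c * s = c * c)
    (ht : ∀ i, t i * t i = 1) (htt : ∀ i, t i * t (i + 1) = t (i + 2))
    (hct : ∀ i, c * t i = t (i + 1) * c) (hk : k * t 0 = s * k) :
    ∃ u ≠ 0, c ∈ signStabilizer ρ u ∧ s ∈ signStabilizer ρ u := by
  obtain ⟨w, hw, hcw⟩ := exists_apply_eq_self ρ hc hcs ht htt hct hk
  obtain ⟨u, hu, hsu, eigen⟩ := exists_mem_signStabilizer ρ hw hs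
  refine ⟨u, hu, .inl ?_, hsu⟩
  simpa [hcs, hcw] using eigen c 1

end Dihedral

section Positions

lemma nonempty_mulEquiv_rotationMatrices {K ι : Type*} [CommRing K] [Finite ι] {φ : K →+* ℝ}
    (hφ : Function.Injective φ) {v : ι → Fin 3 → K} {R : Matrix (Fin 3) (Fin 3) K} {p : Fin 3 → ι}
    (hR : frameMatrix v R p = 1) (Q : E3 ≃ₗᵢ[ℝ] E3) :
    Nonempty (rotationGroup (Q '' vertexSet φ v) ≃* rotationMatrices v) :=
  ⟨(MulEquiv.subgroupCongr (map_conj_rotationGroup Q _).symm).trans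
    (((MulAut.conj Q).subgroupMap _).symm.trans (rotationGroupEquiv hφ hR))⟩

lemma toLp_comp_vec3 {K : Type*} [CommRing K] (φ : K →+* ℝ) (x y z : K) :
    WithLp.toLp 2 (φ ∘ ![x, y, z]) = !₂[φ x, φ y, φ z] := by
  ext a
  fin_cases a <;> rfl

lemma exists_complete_system {G : Subgroup (E3 ≃ₗᵢ[ℝ] E3)} {H : Type*} [Group H] [Finite H]
    (e : G ≃* H) (h : ∀ (n : ℕ) (Δ : H →* Matrix (Fin n) (Fin n) ℂ), (matRep Δ).IsIrreducible →
      IsRealizable (matRep Δ)) :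
    ∃ (r : ℕ) (A : IrrepList G r) (N : Fin r → ℕ → ℕ)
      (I : ∀ p, (Σ l, Fin (N p l)) → Fin (A.d p) → L2S), IsRealOrthonormalBasisSystem A I ∧
        (∀ p l n j, IsSphericalHarmonic l (I p ⟨l, n⟩ j)) ∧ closedSpan I = ⊤ := by
  have : Finite G := .of_equiv H e.symm.toEquiv
  obtain ⟨r, A, hA⟩ := exists_irrepList_hasRealEntries h
  obtain ⟨N, I, hI, harmonic, hspan⟩ := exists_isRealOrthonormalBasisSystem (A.comap e)
  refine ⟨r, A.comap e, N, I, hI, harmonic, top_unique ?_⟩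
  rw [← iSup_isotypic (A.comap e)]
  refine iSup_le fun p => ?_
  rw [← hspan p fun g => hA p (e g)]
  refine Submodule.topologicalClosure_mono (Submodule.span_mono ?_)
  rintro _ ⟨z, j, rfl⟩
  exact ⟨p, z, j, rfl⟩

/-- The matrix of the cyclic permutation of the coordinate axes. -/
def cyclicTurn (K : Type*) [CommRing K] : Matrix (Fin 3) (Fin 3) K :=
  !![0, 0, 1; 1, 0, 0; 0, 1, 0]

/-- The matrix of the half turn about the `i`-th coordinate axis. -/
def halfTurn (K : Type*) [CommRing K] (i : Fin 3) : Matrix (Fin 3) (Fin 3) K :=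
  Matrix.diagonal fun j => if j = i then 1 else -1

end Positions

/-! ### The octahedral group -/

section Octahedral

/-- The vertices of the octahedron. -/
def octaVertex : Fin 6 → Fin 3 → ℚ :=
  ![![1, 0, 0], ![-1, 0, 0], ![0, 1, 0], ![0, -1, 0], ![0, 0, 1], ![0, 0, -1]]

lemma octahedronVertices_eq : octahedronVertices = vertexSet (algebraMap ℚ ℝ) octaVertex := by
  ext x
  rw [vertexSet, ← Set.range_comp]
  simp [toLp_comp_vec3, octahedronVertices, octaVertex, Fin.exists_fin_succ, eq_comm]

lemma frameMatrix_octaVertex : frameMatrix octaVertex 1 ![0, 2, 4] = 1 := by decide +kernel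

instance : Finite (rotationMatrices octaVertex) := finite_rotationMatrices frameMatrix_octaVertex

/-- The half turns about the axes through `(1, 1, 0)` and through `(1, -1, 0)`. -/
def octaHalfTurn (i : Fin 2) : rotationMatrices octaVertex :=
  ⟨⟨![!![0, 1, 0; 1, 0, 0; 0, 0, -1], !![0, -1, 0; -1, 0, 0; 0, 0, -1]] i,
    by revert i; decide +kernel⟩, mem_rotationMatrices.mpr (by revert i; decide +kernel)⟩

lemma exists_mul_octaHalfTurn_involution (g : rotationMatrices octaVertex) :
    ∃ i j : Fin 2, g * (octaHalfTurn 0 ^ (i : ℕ) * octaHalfTurn 1 ^ (j : ℕ)) *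
      (g * (octaHalfTurn 0 ^ (i : ℕ) * octaHalfTurn 1 ^ (j : ℕ))) = 1 := by
  let k (i j : Fin 2) : Matrix (Fin 3) (Fin 3) ℚ :=
    octaHalfTurn 0 ^ (i : ℕ) * octaHalfTurn 1 ^ (j : ℕ)
  obtain ⟨i, j, hij⟩ := forall_mem_rotationMatrices frameMatrix_octaVertex
    (P := fun N => ∃ i j, (N * k i j).transpose = N * k i j) (by decide +kernel) g g.2
  exact ⟨i, j, mul_self_eq_one_of_transpose_eq hij⟩

lemma isRealizable_of_octahedral {V : Type*} [AddCommGroup V] [Module ℂ V] [FiniteDimensional ℂ V]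
    {ρ : Representation ℂ (rotationMatrices octaVertex) V} (hρ : ρ.IsIrreducible) :
    IsRealizable ρ := by
  have := nontrivial_of_isIrreducible hρ
  obtain ⟨u, hu, mem₀, mem₁⟩ := exists_mem_signStabilizer_of_commute ρ
    (a := octaHalfTurn 0) (b := octaHalfTurn 1) (by decide +kernel) (by decide +kernel)
    (by rw [Commute, SemiconjBy]; decide +kernel)
  refine isRealizable_of_involutions hρ hu fun g => ?_
  obtain ⟨i, j, hij⟩ := exists_mul_octaHalfTurn_involution g
  exact ⟨_, mul_mem (pow_mem mem₀ i) (pow_mem mem₁ j), hij⟩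

end Octahedral

/-! ### The icosahedral group -/

section Icosahedral

/-- The field `ℚ(φ)`, where `φ` is the golden ratio. -/
abbrev GoldenField : Type := QuadraticAlgebra ℚ 1 1

/-- The embedding of `ℚ(φ)` into the real numbers. -/
noncomputable def goldenToReal : GoldenField →+* ℝ :=
  (QuadraticAlgebra.lift ⟨Real.goldenRatio, by
    rw [one_smul, one_smul, ← sq, Real.goldenRatio_sq, add_comm]⟩ : GoldenField →ₐ[ℚ] ℝ).toRingHom

lemma goldenToReal_apply (x : GoldenField) :
    goldenToReal x = x.re + x.im * Real.goldenRatio := by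
  simp [goldenToReal, QuadraticAlgebra.lift, Algebra.smul_def]

lemma goldenToReal_injective : Function.Injective goldenToReal := by
  refine (injective_iff_map_eq_zero _).mpr fun x hx => ?_
  rw [goldenToReal_apply] at hx
  have im_eq_zero : x.im = 0 := by
    by_contra him
    refine not_irrational_zero ?_
    rw [← hx]
    exact (Real.goldenRatio_irrational.ratCast_mul him).ratCast_add x.re
  rw [im_eq_zero, Rat.cast_zero, zero_mul, add_zero, Rat.cast_eq_zero] at hx
  exact QuadraticAlgebra.ext hx im_eq_zero

/-- The vertices of the icosahedron; the pair `⟨x, y⟩` stands for `x + y φ`. -/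
def icosaVertex : Fin 12 → Fin 3 → GoldenField :=
  ![![0, 1, ⟨0, 1⟩], ![1, ⟨0, 1⟩, 0], ![⟨0, 1⟩, 0, 1],
    ![0, 1, ⟨0, -1⟩], ![1, ⟨0, -1⟩, 0], ![⟨0, -1⟩, 0, 1],
    ![0, -1, ⟨0, 1⟩], ![-1, ⟨0, 1⟩, 0], ![⟨0, 1⟩, 0, -1],
    ![0, -1, ⟨0, -1⟩], ![-1, ⟨0, -1⟩, 0], ![⟨0, -1⟩, 0, -1]]

lemma icosahedronVertices_eq : icosahedronVertices = vertexSet goldenToReal icosaVertex := by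
  have map_phi : goldenToReal ⟨0, 1⟩ = Real.goldenRatio := by simp [goldenToReal_apply]
  have map_neg_phi : goldenToReal ⟨0, -1⟩ = -Real.goldenRatio := by simp [goldenToReal_apply]
  ext x
  rw [vertexSet, ← Set.range_comp]
  simp [toLp_comp_vec3, icosahedronVertices, icosaVertex, Fin.exists_fin_succ, eq_comm,
    map_phi, map_neg_phi, or_and_right, exists_or, or_assoc]

/-- The inverse of the matrix whose columns are the first three vertices. -/
def icosaInverse : Matrix (Fin 3) (Fin 3) GoldenField :=
  !![⟨1/2, -1/2⟩, ⟨1, -1/2⟩, ⟨1/2, 0⟩; ⟨1, -1/2⟩, ⟨1/2, 0⟩, ⟨1/2, -1/2⟩;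
    ⟨1/2, 0⟩, ⟨1/2, -1/2⟩, ⟨1, -1/2⟩]

lemma frameMatrix_icosaVertex : frameMatrix icosaVertex icosaInverse ![0, 1, 2] = 1 := by
  decide +kernel

instance : Finite (rotationMatrices icosaVertex) := finite_rotationMatrices frameMatrix_icosaVertex

/-- The cyclic permutation of the coordinate axes. -/
def icosaCyclicTurn : rotationMatrices icosaVertex :=
  ⟨⟨cyclicTurn _, by decide +kernel⟩, mem_rotationMatrices.mpr (by decide +kernel)⟩

/-- The half turns about the coordinate axes. -/
def icosaAxisTurn (i : Fin 3) : rotationMatrices icosaVertex :=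
  ⟨⟨halfTurn _ i, by revert i; decide +kernel⟩,
    mem_rotationMatrices.mpr (by revert i; decide +kernel)⟩

/-- The matrix of a half turn which conjugates `cyclicTurn` to its inverse. -/
def icosaHalfTurnMatrix : Matrix (Fin 3) (Fin 3) GoldenField :=
  !![⟨0, -1/2⟩, ⟨-1/2, 0⟩, ⟨-1/2, 1/2⟩; ⟨-1/2, 0⟩, ⟨-1/2, 1/2⟩, ⟨0, -1/2⟩;
    ⟨-1/2, 1/2⟩, ⟨0, -1/2⟩, ⟨-1/2, 0⟩]

/-- The half turn with the matrix `icosaHalfTurnMatrix`. -/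
def icosaHalfTurn : rotationMatrices icosaVertex :=
  ⟨⟨icosaHalfTurnMatrix, by decide +kernel⟩, mem_rotationMatrices.mpr (by decide +kernel)⟩

/-- A rotation which conjugates `icosaAxisTurn 0` to `icosaHalfTurn`. -/
def icosaConjugator : rotationMatrices icosaVertex :=
  ⟨⟨!![⟨-1/2, 1/2⟩, ⟨0, 1/2⟩, ⟨-1/2, 0⟩; ⟨0, -1/2⟩, ⟨1/2, 0⟩, ⟨-1/2, 1/2⟩;
    ⟨1/2, 0⟩, ⟨-1/2, 1/2⟩, ⟨0, 1/2⟩], by decide +kernel⟩,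
    mem_rotationMatrices.mpr (by decide +kernel)⟩

lemma exists_mul_icosahedral_involution (g : rotationMatrices icosaVertex) :
    ∃ (i : Fin 3) (j : Fin 2), g * (icosaCyclicTurn ^ (i : ℕ) * icosaHalfTurn ^ (j : ℕ)) *
      (g * (icosaCyclicTurn ^ (i : ℕ) * icosaHalfTurn ^ (j : ℕ))) = 1 := by
  let k (i : Fin 3) (j : Fin 2) : Matrix (Fin 3) (Fin 3) GoldenField :=
    cyclicTurn _ ^ (i : ℕ) * icosaHalfTurnMatrix ^ (j : ℕ)
  obtain ⟨i, j, hij⟩ := forall_mem_rotationMatrices frameMatrix_icosaVertex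
    (P := fun N => ∃ i j, (N * k i j).transpose = N * k i j) (by decide +kernel) g g.2
  exact ⟨i, j, mul_self_eq_one_of_transpose_eq hij⟩

lemma isRealizable_of_icosahedral {V : Type*} [AddCommGroup V] [Module ℂ V] [FiniteDimensional ℂ V]
    {ρ : Representation ℂ (rotationMatrices icosaVertex) V} (hρ : ρ.IsIrreducible) :
    IsRealizable ρ := by
  have := nontrivial_of_isIrreducible hρ
  obtain ⟨u, hu, mem_cyclic, mem_half⟩ := exists_mem_signStabilizer_of_dihedral ρ
    (c := icosaCyclicTurn) (s := icosaHalfTurn) (k := icosaConjugator) (t := icosaAxisTurn)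
    (by decide +kernel) (by decide +kernel) (by decide +kernel) (by decide +kernel)
    (by decide +kernel) (by decide +kernel) (by decide +kernel)
  refine isRealizable_of_involutions hρ hu fun g => ?_
  obtain ⟨i, j, hij⟩ := exists_mul_icosahedral_involution g
  exact ⟨_, mul_mem (pow_mem mem_cyclic i) (pow_mem mem_half j), hij⟩

end Icosahedral

lemma exists_complete_system_of_isOctahedral_or_isIcosahedral {G : Subgroup (E3 ≃ₗᵢ[ℝ] E3)}
    (hG : IsOctahedral G ∨ IsIcosahedral G) :
    ∃ (r : ℕ) (A : IrrepList G r) (N : Fin r → ℕ → ℕ)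
      (I : ∀ p, (Σ l, Fin (N p l)) → Fin (A.d p) → L2S), IsRealOrthonormalBasisSystem A I ∧
        (∀ p l n j, IsSphericalHarmonic l (I p ⟨l, n⟩ j)) ∧ closedSpan I = ⊤ := by
  rcases hG with ⟨Q, rfl⟩ | ⟨Q, rfl⟩
  · rw [octahedronVertices_eq]
    obtain ⟨e⟩ := nonempty_mulEquiv_rotationMatrices (algebraMap ℚ ℝ).injective
      frameMatrix_octaVertex Q
    exact exists_complete_system e fun n Δ hΔ => isRealizable_of_octahedral hΔ
  · rw [icosahedronVertices_eq]
    obtain ⟨e⟩ := nonempty_mulEquiv_rotationMatrices goldenToReal_injective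
      frameMatrix_icosaVertex Q
    exact exists_complete_system e fun n Δ hΔ => isRealizable_of_icosahedral hΔ

/-! ### Characters and real basis functions -/

section Characters

variable {G : Type*} [Group G]

lemma isIrreducible_of_forall_eq_top {k V : Type*} [Field k] [AddCommGroup V] [Module k V]
    [Nontrivial V] {ρ : Representation k G V}
    (h : ∀ W : Submodule k V, (∀ g, ∀ w ∈ W, ρ g w ∈ W) → W ≠ ⊥ → W = ⊤) : ρ.IsIrreducible where
  exists_pair_ne := ⟨⊥, ⊤, fun hbt => bot_ne_top (congrArg Subrepresentation.toSubmodule hbt)⟩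
  eq_bot_or_eq_top W := by
    by_cases hW : W.toSubmodule = ⊥
    · exact .inl (Subrepresentation.toSubmodule_injective hW)
    · exact .inr (Subrepresentation.toSubmodule_injective
        (h _ (fun g w hw => W.apply_mem_toSubmodule g hw) hW))

/-- The one-dimensional matrix representation given by a character. -/
noncomputable def charRep (χ : G →* ℂ) : G →* Matrix (Fin 1) (Fin 1) ℂ :=
  (Matrix.scalar (Fin 1)).toMonoidHom.comp χ

lemma charRep_apply (χ : G →* ℂ) (g : G) : charRep χ g = Matrix.scalar (Fin 1) (χ g) := rfl

lemma matRep_charRep (χ : G →* ℂ) (g : G) (v : Fin 1 → ℂ) : matRep (charRep χ) g v = χ g • v := by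
  rw [matRep_apply, charRep_apply, Matrix.scalar_apply, ← Matrix.smul_one_eq_diagonal,
    Matrix.smul_mulVec, Matrix.one_mulVec]

lemma charRep_mem_unitaryGroup {χ : G →* ℂ} {g : G} (h : ‖χ g‖ = 1) :
    charRep χ g ∈ Matrix.unitaryGroup (Fin 1) ℂ := by
  rw [Matrix.mem_unitaryGroup_iff, charRep_apply, Matrix.scalar_apply, Matrix.star_eq_conjTranspose,
    Matrix.diagonal_conjTranspose, Matrix.diagonal_mul_diagonal, Matrix.diagonal_eq_one]
  ext
  exact (Complex.mul_conj' _).trans (by rw [h, Complex.ofReal_one, one_pow, Pi.one_apply])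

lemma isIrreducible_charRep (χ : G →* ℂ) : (matRep (charRep χ)).IsIrreducible := by
  refine isIrreducible_of_forall_eq_top fun W _ hW => ?_
  have : IsSimpleModule ℂ (Fin 1 → ℂ) :=
    isSimpleModule_iff_finrank_eq_one.mpr (Module.finrank_fin_fun ℂ)
  exact (eq_bot_or_eq_top W).resolve_left hW

lemma eq_of_nonempty_equiv_charRep {χ ψ : G →* ℂ}
    (h : Nonempty ((matRep (charRep χ)).Equiv (matRep (charRep ψ)))) : χ = ψ := by
  obtain ⟨e⟩ := h
  ext g
  have apply_e := LinearMap.congr_fun (e.isIntertwining' g) 1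
  rw [LinearMap.comp_apply, LinearMap.comp_apply, matRep_charRep, matRep_charRep, map_smul]
    at apply_e
  exact smul_left_injective ℂ (e.toLinearEquiv.map_ne_zero_iff.mpr one_ne_zero) apply_e

lemma dim_eq_of_nonempty_equiv {d e : ℕ} {Γ : G →* Matrix (Fin d) (Fin d) ℂ}
    {Δ : G →* Matrix (Fin e) (Fin e) ℂ} (h : Nonempty ((matRep Γ).Equiv (matRep Δ))) : d = e := by
  obtain ⟨f⟩ := h
  simpa only [Module.finrank_fin_fun] using f.toLinearEquiv.finrank_eq

lemma nonempty_equiv_of_eq_one {d e : ℕ} {Γ : G →* Matrix (Fin d) (Fin d) ℂ}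
    {Δ : G →* Matrix (Fin e) (Fin e) ℂ} (hde : d = e) (hΓ : ∀ g, Γ g = 1) (hΔ : ∀ g, Δ g = 1) :
    Nonempty ((matRep Γ).Equiv (matRep Δ)) := by
  subst hde
  obtain rfl : Γ = Δ := MonoidHom.ext fun g => (hΓ g).trans (hΔ g).symm
  exact ⟨.refl _⟩

lemma HasRealEntries.sq_eq_one {d : ℕ} [Subsingleton (Fin d)] {Γ : G →* Matrix (Fin d) (Fin d) ℂ}
    (hreal : HasRealEntries Γ) {g : G} (hg : Γ g ∈ Matrix.unitaryGroup (Fin d) ℂ) :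
    Γ g ^ 2 = 1 := by
  have star_eq : star (Γ g) = Γ g := by
    ext i j
    rw [Subsingleton.elim i j, Matrix.star_apply]
    exact Complex.conj_eq_iff_im.mpr (hreal g j j)
  rw [sq, ← Matrix.mem_unitaryGroup_iff.mp hg, star_eq]

end Characters

lemma hasRealEntries_of_isBasisFunction {G : Subgroup (E3 ≃ₗᵢ[ℝ] E3)} {d : ℕ}
    {Γ : G →* Matrix (Fin d) (Fin d) ℂ} {f : Fin d → L2S} (hf : IsBasisFunction Γ f)
    (hreal : ∀ j, IsRealValued (f j)) (hli : LinearIndependent ℂ f) : HasRealEntries Γ := by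
  intro g i j
  have star_f (k : Fin d) : star (f k) = f k := isRealValued_iff.mp (hreal k)
  have translate_f := isBasisFunction_iff.mp hf g j
  have translate_f_star : translate g (f j) = ∑ k, star (Γ g k j) • f k := by
    rw [← star_f j, translate_star, translate_f, star_sum]
    exact Finset.sum_congr rfl fun k _ => by rw [star_smul, star_f]
  exact Complex.conj_eq_iff_im.mp
    (hli.eq_coords_of_eq (translate_f_star.symm.trans translate_f) i)

/-! ### The tetrahedral group -/

section Tetrahedral

/-- The vertices of the tetrahedron. -/
def tetraVertex : Fin 4 → Fin 3 → ℚ :=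
  ![![1, 1, 1], ![1, -1, -1], ![-1, 1, -1], ![-1, -1, 1]]

lemma tetrahedronVertices_eq : tetrahedronVertices = vertexSet (algebraMap ℚ ℝ) tetraVertex := by
  ext x
  rw [vertexSet, ← Set.range_comp]
  simp [toLp_comp_vec3, tetrahedronVertices, tetraVertex, Fin.exists_fin_succ, eq_comm]

/-- The inverse of the matrix whose columns are the first three vertices. -/
def tetraInverse : Matrix (Fin 3) (Fin 3) ℚ :=
  !![1/2, 1/2, 0; 1/2, 0, -1/2; 0, 1/2, -1/2]

lemma frameMatrix_tetraVertex : frameMatrix tetraVertex tetraInverse ![0, 1, 2] = 1 := by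
  decide +kernel

instance : Finite (rotationMatrices tetraVertex) := finite_rotationMatrices frameMatrix_tetraVertex

/-- The cyclic permutation of the coordinate axes. -/
def tetraCyclicTurn : rotationMatrices tetraVertex :=
  ⟨⟨cyclicTurn _, by decide +kernel⟩, mem_rotationMatrices.mpr (by decide +kernel)⟩

/-- The half turns about the coordinate axes. -/
def tetraAxisTurn (i : Fin 3) : rotationMatrices tetraVertex :=
  ⟨⟨halfTurn _ i, by revert i; decide +kernel⟩,
    mem_rotationMatrices.mpr (by revert i; decide +kernel)⟩

/-- The matrices of the tetrahedral group, indexed by its factorization into the Klein four-group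
of the half turns and the cyclic group of order three. -/
def tetraMatrix (x : Fin 2 × Fin 2 × Fin 3) : Matrix (Fin 3) (Fin 3) ℚ :=
  halfTurn ℚ 0 ^ (x.1 : ℕ) * halfTurn ℚ 1 ^ (x.2.1 : ℕ) * cyclicTurn ℚ ^ (x.2.2 : ℕ)

lemma exists_eq_tetraMatrix (N : rotationMatrices tetraVertex) :
    ∃ x, (N : Matrix (Fin 3) (Fin 3) ℚ) = tetraMatrix x :=
  forall_mem_rotationMatrices frameMatrix_tetraVertex (P := fun N => ∃ x, N = tetraMatrix x)
    (by decide +kernel) N N.2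

lemma card_rotationMatrices_tetraVertex_le : Nat.card (rotationMatrices tetraVertex) ≤ 12 := by
  choose x hx using exists_eq_tetraMatrix
  have inj : Function.Injective x := fun M N hMN =>
    Subtype.ext (Subtype.ext (by rw [hx M, hx N, hMN]))
  simpa using Nat.card_le_card_of_injective x inj

/-- The power of the cyclic permutation by which the given rotation of the tetrahedron permutes the
coordinate axes. -/
def axisShift (N : Matrix (Fin 3) (Fin 3) ℚ) : ZMod 3 :=
  if N 0 0 ≠ 0 then 0 else if N 1 0 ≠ 0 then 1 else 2

lemma axisShift_mul (M N : rotationMatrices tetraVertex) :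
    axisShift ((M * N : rotationMatrices tetraVertex) : Matrix (Fin 3) (Fin 3) ℚ) =
      axisShift (M : Matrix (Fin 3) (Fin 3) ℚ) + axisShift (N : Matrix (Fin 3) (Fin 3) ℚ) := by
  obtain ⟨x, hx⟩ := exists_eq_tetraMatrix M
  obtain ⟨y, hy⟩ := exists_eq_tetraMatrix N
  have additive : ∀ x y, axisShift (tetraMatrix x * tetraMatrix y) =
      axisShift (tetraMatrix x) + axisShift (tetraMatrix y) := by decide +kernel
  rw [hx, hy, ← additive, ← hx, ← hy]
  rfl

/-- The characters of the tetrahedral group, through its quotient of order three. -/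
noncomputable def tetraCharacter (a : ZMod 3) : rotationMatrices tetraVertex →* ℂ where
  toFun N := ZMod.stdAddChar (a * axisShift (N : Matrix (Fin 3) (Fin 3) ℚ))
  map_one' := by
    have axisShift_one : axisShift (1 : Matrix (Fin 3) (Fin 3) ℚ) = 0 := by decide +kernel
    rw [Subgroup.coe_one, Matrix.SpecialLinearGroup.coe_one, axisShift_one, mul_zero,
      AddChar.map_zero_eq_one]
  map_mul' M N := by rw [axisShift_mul, mul_add, AddChar.map_add_eq_mul]

lemma tetraCharacter_apply (a : ZMod 3) (N : rotationMatrices tetraVertex) :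
    tetraCharacter a N = ZMod.stdAddChar (a * axisShift (N : Matrix (Fin 3) (Fin 3) ℚ)) := rfl

lemma norm_tetraCharacter (a : ZMod 3) (N : rotationMatrices tetraVertex) :
    ‖tetraCharacter a N‖ = 1 :=
  Circle.norm_coe (ZMod.toCircle _)

lemma tetraCharacter_injective : Function.Injective tetraCharacter := fun a b hab => by
  have axisShift_turn : axisShift (tetraCyclicTurn : Matrix (Fin 3) (Fin 3) ℚ) = 1 := by
    decide +kernel
  have apply_turn (a : ZMod 3) : tetraCharacter a tetraCyclicTurn = ZMod.stdAddChar a := by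
    rw [tetraCharacter_apply, axisShift_turn, mul_one]
  apply ZMod.injective_stdAddChar
  rw [← apply_turn, hab, apply_turn]

lemma tetraCharacter_zero : tetraCharacter 0 = 1 := by
  ext N
  rw [tetraCharacter_apply, zero_mul, AddChar.map_zero_eq_one, MonoidHom.one_apply]

/-- The representation of the tetrahedral group by the rotations themselves. -/
noncomputable def tetraRotations : rotationMatrices tetraVertex →* Matrix (Fin 3) (Fin 3) ℂ where
  toFun N := (N : Matrix (Fin 3) (Fin 3) ℚ).map (Rat.castHom ℂ)
  map_one' := Matrix.map_one _ (map_zero _) (map_one _)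
  map_mul' _ _ := Matrix.map_mul

lemma hasRealEntries_tetraRotations : HasRealEntries tetraRotations :=
  fun _ _ _ => Complex.ratCast_im _

lemma tetraRotations_mem_unitaryGroup (N : rotationMatrices tetraVertex) :
    tetraRotations N ∈ Matrix.unitaryGroup (Fin 3) ℂ := by
  have star_eq : star (tetraRotations N) =
      (N : Matrix (Fin 3) (Fin 3) ℚ).transpose.map (Rat.castHom ℂ) := by
    ext i j
    exact Complex.conj_eq_iff_im.mpr (hasRealEntries_tetraRotations N j i)
  rw [Matrix.mem_unitaryGroup_iff', star_eq]
  refine Matrix.map_mul.symm.trans ?_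
  rw [transpose_mul_self_of_mem_rotationMatrices N.2]
  exact Matrix.map_one _ (map_zero _) (map_one _)

lemma tetraRotations_cyclicTurn_single (i : Fin 3) (z : ℂ) :
    matRep tetraRotations tetraCyclicTurn (Pi.single i z) = Pi.single (i + 1) z := by
  rw [matRep_apply]
  ext j
  fin_cases i <;> fin_cases j <;>
    simp [tetraRotations, tetraCyclicTurn, cyclicTurn]

lemma add_tetraRotations_axisTurn (i : Fin 3) (w : Fin 3 → ℂ) :
    w + matRep tetraRotations (tetraAxisTurn i) w = Pi.single i (2 * w i) := by
  rw [matRep_apply]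
  ext j
  have matrix_eq : tetraRotations (tetraAxisTurn i) =
      Matrix.diagonal fun j => if j = i then 1 else -1 := by
    refine (Matrix.diagonal_map (map_zero _)).trans ?_
    simp [apply_ite]
  rw [matrix_eq, Pi.add_apply, Matrix.mulVec_diagonal]
  rcases eq_or_ne j i with rfl | hj
  · simp [two_mul]
  · simp [hj]

lemma isIrreducible_tetraRotations : (matRep tetraRotations).IsIrreducible := by
  refine isIrreducible_of_forall_eq_top fun W hW hne => ?_
  obtain ⟨w, hw, w_ne⟩ := W.ne_bot_iff.mp hne
  obtain ⟨i, hi⟩ := Function.ne_iff.mp w_ne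
  have shift_mem {j : Fin 3} (hj : Pi.single j 1 ∈ W) : Pi.single (j + 1) 1 ∈ W :=
    tetraRotations_cyclicTurn_single j 1 ▸ hW tetraCyclicTurn _ hj
  have single_mem : Pi.single i 1 ∈ W := by
    have smul_mem := W.smul_mem (2 * w i)⁻¹ (W.add_mem hw (hW (tetraAxisTurn i) w hw))
    rwa [add_tetraRotations_axisTurn, ← Pi.single_smul, smul_eq_mul,
      inv_mul_cancel₀ (mul_ne_zero two_ne_zero hi)] at smul_mem
  have exhaust : ∀ i j : Fin 3, j = i ∨ j = i + 1 ∨ j = i + 1 + 1 := by decide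
  rw [eq_top_iff, ← (Pi.basisFun ℂ (Fin 3)).span_eq, Submodule.span_le]
  rintro _ ⟨j, rfl⟩
  rw [Pi.basisFun_apply]
  obtain rfl | rfl | rfl := exhaust i j
  exacts [single_mem, shift_mem single_mem, shift_mem (shift_mem single_mem)]

/-- The four irreducible representations of the tetrahedral group. -/
noncomputable def tetraMatrices : ∀ p : Fin 4,
    rotationMatrices tetraVertex →* Matrix (Fin (![1, 1, 1, 3] p)) (Fin (![1, 1, 1, 3] p)) ℂ
  | 0 => charRep (tetraCharacter 0)
  | 1 => charRep (tetraCharacter 1)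
  | 2 => charRep (tetraCharacter 2)
  | 3 => tetraRotations

lemma isIrreducible_tetraMatrices : ∀ p, (matRep (tetraMatrices p)).IsIrreducible
  | 0 | 1 | 2 => isIrreducible_charRep _
  | 3 => isIrreducible_tetraRotations

lemma tetraMatrices_inequivalent (p q : Fin 4)
    (h : Nonempty ((matRep (tetraMatrices p)).Equiv (matRep (tetraMatrices q)))) : p = q := by
  fin_cases p <;> fin_cases q <;> first
    | rfl
    | exact absurd (dim_eq_of_nonempty_equiv h) (by decide)
    | exact absurd (tetraCharacter_injective (eq_of_nonempty_equiv_charRep h)) (by decide)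

/-- The list of the irreducible representations of the tetrahedral group. -/
noncomputable def tetraIrreps : IrrepList (rotationMatrices tetraVertex) 4 where
  d := ![1, 1, 1, 3]
  Γ := tetraMatrices
  unitary
    | 0 | 1 | 2 => fun N => charRep_mem_unitaryGroup (norm_tetraCharacter _ N)
    | 3 => tetraRotations_mem_unitaryGroup
  irreducible := isIrreducible_tetraMatrices
  inequivalent := tetraMatrices_inequivalent
  exhaustive _ _ hΔ := exists_equiv_of_card_le_sum_sq_dim isIrreducible_tetraMatrices
    tetraMatrices_inequivalent (card_rotationMatrices_tetraVertex_le.trans (by decide)) hΔ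

lemma tetraIrreps_apply_zero (N : rotationMatrices tetraVertex) : tetraIrreps.Γ 0 N = 1 := by
  refine (charRep_apply _ N).trans ?_
  rw [tetraCharacter_zero, MonoidHom.one_apply, map_one]
  rfl

lemma eq_one_of_sq_eq_one {M : Type*} [Monoid M] (f : rotationMatrices tetraVertex →* M)
    (hf : ∀ N, f N ^ 2 = 1) (N : rotationMatrices tetraVertex) : f N = 1 := by
  have of_pow_three {N : rotationMatrices tetraVertex} (hN : N ^ 3 = 1) : f N = 1 := by
    calc f N = f N ^ 2 * f N := by rw [hf, one_mul]
      _ = f (N ^ 3) := by rw [← pow_succ, map_pow]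
      _ = 1 := by rw [hN, map_one]
  obtain ⟨x, hx⟩ := exists_eq_tetraMatrix N
  have order : ∀ x, tetraMatrix x ^ 3 = 1 ∨ (tetraMatrix x * cyclicTurn ℚ) ^ 3 = 1 := by
    decide +kernel
  rcases hx ▸ order x with h | h
  · exact of_pow_three (Subtype.ext (Subtype.ext h))
  · have map_mul_turn : f (N * tetraCyclicTurn) = 1 :=
      of_pow_three (Subtype.ext (Subtype.ext h))
    rwa [map_mul, of_pow_three (N := tetraCyclicTurn) (by decide +kernel), mul_one]
      at map_mul_turn

end Tetrahedral

section TetrahedralSystems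

variable {G : Subgroup (E3 ≃ₗᵢ[ℝ] E3)}

lemma nonempty_mulEquiv_tetrahedral (hG : IsTetrahedral G) :
    Nonempty (G ≃* rotationMatrices tetraVertex) := by
  obtain ⟨Q, rfl⟩ := hG
  rw [tetrahedronVertices_eq]
  exact nonempty_mulEquiv_rotationMatrices (algebraMap ℚ ℝ).injective frameMatrix_tetraVertex Q

lemma exists_isTetrahedralNumbering_system (e : G ≃* rotationMatrices tetraVertex) :
    ∃ (A : IrrepList G 4) (N : Fin 4 → ℕ → ℕ)
      (I : ∀ p, (Σ l, Fin (N p l)) → Fin (A.d p) → L2S), A.IsTetrahedralNumbering ∧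
        IsRealOrthonormalBasisSystem A I ∧ (∀ p l n j, IsSphericalHarmonic l (I p ⟨l, n⟩ j)) ∧
        closedSpanAt I 0 = isotypic (A.Γ 0) ∧ closedSpanAt I 3 = isotypic (A.Γ 3) := by
  have : Finite G := .of_equiv _ e.symm.toEquiv
  obtain ⟨N, I, hI, harmonic, hspan⟩ := exists_isRealOrthonormalBasisSystem (tetraIrreps.comap e)
  have map_one (g : G) : (tetraIrreps.comap e).Γ 0 g = 1 := tetraIrreps_apply_zero (e g)
  refine ⟨_, N, I, ⟨rfl, map_one⟩, hI, harmonic, hspan 0 fun g i j => ?_,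
    hspan 3 fun g => hasRealEntries_tetraRotations (e g)⟩
  rw [map_one, Matrix.one_apply]
  split_ifs <;> rfl

variable {A : IrrepList G 4} {ζ : Fin 4 → Type*} {I : ∀ p, ζ p → Fin (A.d p) → L2S}

lemma isEmpty_of_isRealOrthonormalBasisSystem (e : G ≃* rotationMatrices tetraVertex)
    (hA : A.IsTetrahedralNumbering) (hI : IsRealOrthonormalBasisSystem A I) {p : Fin 4}
    (hp : p ≠ 0) (hd : A.d p = 1) : IsEmpty (ζ p) := by
  refine ⟨fun z => hp (A.inequivalent p 0
    (nonempty_equiv_of_eq_one (hd.trans (congrFun hA.1 0).symm) (fun g => ?_) hA.2))⟩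
  have orthonormal : Orthonormal ℂ (I p z) :=
    hI.orthonormal.comp (fun j => ⟨p, z, j⟩) fun i j hij => by simpa using hij
  have real : HasRealEntries (A.Γ p) :=
    hasRealEntries_of_isBasisFunction (hI.transforms p z) (hI.real p z)
      orthonormal.linearIndependent
  have : Subsingleton (Fin (A.d p)) := by rw [hd]; infer_instance
  rw [← e.symm_apply_apply g]
  exact eq_one_of_sq_eq_one ((A.Γ p).comp e.symm.toMonoidHom)
    (fun N => real.sq_eq_one (A.unitary p (e.symm N))) (e g)

lemma closedSpan_le_of_isEmpty (hI : IsRealOrthonormalBasisSystem A I) (h₁ : IsEmpty (ζ 1))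
    (h₂ : IsEmpty (ζ 2)) :
    closedSpan I ≤ (isotypic (A.Γ 0) ⊔ isotypic (A.Γ 3)).topologicalClosure := by
  refine Submodule.topologicalClosure_mono (Submodule.span_le.mpr ?_)
  rintro _ ⟨p, z, j, rfl⟩
  have mem_isotypic : I p z j ∈ isotypic (A.Γ p) :=
    Submodule.le_topologicalClosure _ (Submodule.subset_span ⟨I p z, hI.transforms p z, j, rfl⟩)
  fin_cases p
  · exact Submodule.mem_sup_left mem_isotypic
  · exact h₁.elim z
  · exact h₂.elim z
  · exact Submodule.mem_sup_right mem_isotypic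

end TetrahedralSystems

end Polyhedral

theorem corollary1 :
    -- octahedral and icosahedral groups
    (∀ G : Subgroup (Polyhedral.E3 ≃ₗᵢ[ℝ] Polyhedral.E3),
      (Polyhedral.IsOctahedral G ∨ Polyhedral.IsIcosahedral G) →
      ∃ (r : ℕ) (A : Polyhedral.IrrepList G r) (N : Fin r → ℕ → ℕ)
        (I : ∀ p, (Σ l, Fin (N p l)) → Fin (A.d p) → Polyhedral.L2S),
        Polyhedral.IsRealOrthonormalBasisSystem A I ∧
        (∀ p l n j, Polyhedral.IsSphericalHarmonic l (I p ⟨l, n⟩ j)) ∧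
        Polyhedral.closedSpan I = ⊤) ∧
    -- tetrahedral group
    (∀ G : Subgroup (Polyhedral.E3 ≃ₗᵢ[ℝ] Polyhedral.E3), Polyhedral.IsTetrahedral G →
      (∃ (A : Polyhedral.IrrepList G 4) (N : Fin 4 → ℕ → ℕ)
        (I : ∀ p, (Σ l, Fin (N p l)) → Fin (A.d p) → Polyhedral.L2S),
        A.IsTetrahedralNumbering ∧
        Polyhedral.IsRealOrthonormalBasisSystem A I ∧
        (∀ p l n j, Polyhedral.IsSphericalHarmonic l (I p ⟨l, n⟩ j)) ∧
        Polyhedral.closedSpanAt I 0 = Polyhedral.isotypic (A.Γ 0) ∧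
        Polyhedral.closedSpanAt I 3 = Polyhedral.isotypic (A.Γ 3)) ∧
      (∀ A : Polyhedral.IrrepList G 4, A.IsTetrahedralNumbering →
        ∀ (ζ : Fin 4 → Type) (I : ∀ p, ζ p → Fin (A.d p) → Polyhedral.L2S),
          Polyhedral.IsRealOrthonormalBasisSystem A I →
          IsEmpty (ζ 1) ∧ IsEmpty (ζ 2) ∧
          Polyhedral.closedSpan I ≤
            (Polyhedral.isotypic (A.Γ 0) ⊔ Polyhedral.isotypic (A.Γ 3)).topologicalClosure ∧
          Polyhedral.closedSpan I ≠ ⊤)) := by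
  refine ⟨fun G hG => Polyhedral.exists_complete_system_of_isOctahedral_or_isIcosahedral hG,
    fun G hG => ?_⟩
  obtain ⟨e⟩ := Polyhedral.nonempty_mulEquiv_tetrahedral hG
  refine ⟨Polyhedral.exists_isTetrahedralNumbering_system e, fun A hA ζ I hI => ?_⟩
  have h₁ := Polyhedral.isEmpty_of_isRealOrthonormalBasisSystem e hA hI (p := 1) (by decide)
    (congrFun hA.1 1)
  have h₂ := Polyhedral.isEmpty_of_isRealOrthonormalBasisSystem e hA hI (p := 2) (by decide)
    (congrFun hA.1 2)
  have : Finite G := .of_equiv _ e.symm.toEquiv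
  exact ⟨h₁, h₂, Polyhedral.closedSpan_le_of_isEmpty hI h₁ h₂, fun h =>
    not_nonempty_iff.mpr h₁ (Polyhedral.nonempty_of_closedSpan_eq_top hI h 1)⟩
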